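/- Let $\mathbf k$ be a field of characteristic zero and let $n\ge 2$. All operads are symmetric operads in graded $\mathbf k$-vector spaces, with partial compositions $\circ_i$. For $d\in\mathbb Z$ let $\Gamma(\mu)$ be the free operad on one operation $\mu$ of arity $n$ and degree $d$ without symmetry (i.e. on the regular representation $\mathbf k[\Sigma_n]\mu$ placed in arity $n$ and degree $d$), and let $(R)$ denote the operadic ideal generated by $R\subset\Gamma(\mu)(2n-1)$. Put $$t\mathcal{A}ss^n_d=\Gamma(\mu)/(\mu\circ_i\mu-\mu\circ_j\mu,\ 1\le i,j\le n),\qquad p\mathcal{A}ss^n_d=\Gamma(\mu)/\Big(\sum_{i=1}^n(-1)^{(i+1)(n-1)}\mu\circ_i\mu\Big),$$ $$t\widetilde{\mathcal{A}ss}{}^n_d=\mathbf s\,t\mathcal{A}ss^n_{d-n+1},\qquad p\widetilde{\mathcal{A}ss}{}^n_d=\mathbf s^{-1}p\mathcal{A}ss^n_{d+n-1},$$ where $\mathbf s$ is the operadic suspension, $(\mathbf s\mathcal P)(a)=\mathrm{sgn}_a\otimes{\uparrow}^{a-1}\mathcal P(a)$, with structure operations given by the Koszul sign rule. For a quadratic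 operad $\mathcal P=\Gamma(E)/(R)$ with $E$ concentrated in arity $n$ and $R\subset\Gamma(E)(2n-1)$ a $\Sigma_{2n-1}$-invariant subspace, the Koszul dual is $\mathcal P^!=\Gamma(E^\vee)/(R^\perp)$, where $E^\vee=\mathrm{sgn}_n\otimes{\uparrow}^{n-2}E^\#$ (with $\#$ the graded linear dual) and $R^\perp$ is the annihilator of $R$ in the pairing of $\Gamma(E^\vee)(2n-1)$ with $\Gamma(E)(2n-1)$ that is equivariant up to the sign representation and determined by $\langle{\uparrow}^{n-2}e'\circ_i{\uparrow}^{n-2}f'\mid e''\circ_jf''\rangle=\delta_{ij}(-1)^{(i+1)(n+1)}e'(e'')f'(f'')$. The dual bar construction of an operad $\mathcal Q$ with finite-dimensional components is the dg-operad $\mathsf D(\mathcal Q)=(\Gamma({\downarrow}\overline{\mathbf s\mathcal Q^\#}),\partial)$, where the bar is the coaugmentation coideal and $\partial$ is the derivation of degree $-1$ induced by the partial compositions of $\mathcal Q$. The operad $\mathcal P$ is called Koszul if the natural map $\mathsf D(\mathcal P^!)\to\mathcal P$, which is the canonical isomorphism ${\downarrow}\mathbf s(E^\vee)^\#\cong E$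 on the generators of arity $n$ and zero on the other generators, is a homology equivalence (with zero differential on $\mathcal P$). Let $\mathcal P^n_d$ be one of the four families $t\mathcal{A}ss^n_d$, $p\mathcal{A}ss^n_d$, $t\widetilde{\mathcal{A}ss}{}^n_d$, $p\widetilde{\mathcal{A}ss}{}^n_d$. Then, for every $d\in\mathbb Z$, $\mathcal P^n_d$ is Koszul if and only if $\mathcal P^n_{d+2}$ is Koszul. That is, only the parity of $d$ matters: if $d\equiv d'\pmod 2$, then $\mathcal P^n_d$ is Koszul if and only if $\mathcal P^n_{d'}$ is. -/

import Mathlib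

noncomputable section

namespace Operads

open Equiv (Perm)

universe u

/-- `planar i h` numbers the inputs of the partial composition `x ∘ᵢ y` of an operation `x` with `m`
inputs and an operation `y` with `n` inputs from left to right: the inputs of `x` before `i` keep
their numbers, then come the `n` inputs of `y`, then the inputs of `x` after `i`.
(All inputs are numbered from `0`.) -/
def planar {m n l : ℕ} (i : Fin m) (h : m + n = l + 1) :
    {x : Fin m // x ≠ i} ⊕ Fin n ≃ Fin l :=
  Equiv.ofBijective
    (Sum.elim
      (fun x => if hx : (x.1 : ℕ) < i then ⟨x.1, by omega⟩ else
        ⟨(x.1 : ℕ) + n - 1, by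
          have := x.1.2; have := fun H => x.2 (Fin.ext H); omega⟩)
      (fun y => ⟨(i : ℕ) + y, by omega⟩)) (by
    rw [Fintype.bijective_iff_injective_and_card]
    refine ⟨?_, ?_⟩
    · rintro (⟨x, hx⟩ | x) (⟨y, hy⟩ | y) hxy
      · have h1 := fun H => hx (Fin.ext H)
        have h2 := fun H => hy (Fin.ext H)
        simp only [Sum.elim_inl] at hxy
        have : x = y := by
          apply Fin.ext
          split_ifs at hxy <;> simp only [Fin.mk.injEq] at hxy <;> omega
        subst this; rfl
      · exfalso
        have h1 := fun H => hx (Fin.ext H)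
        simp only [Sum.elim_inl, Sum.elim_inr] at hxy
        split_ifs at hxy <;> simp only [Fin.mk.injEq] at hxy <;> omega
      · exfalso
        have h2 := fun H => hy (Fin.ext H)
        simp only [Sum.elim_inl, Sum.elim_inr] at hxy
        split_ifs at hxy <;> simp only [Fin.mk.injEq] at hxy <;> omega
      · simp only [Sum.elim_inr, Fin.mk.injEq] at hxy
        congr 1; apply Fin.ext; omega
    · have := i.2
      simp only [Fintype.card_sum, Fintype.card_fin, ne_eq, Fintype.card_subtype_compl,
        Fintype.card_unique]
      omega)

/-- The permutation `σ ∘ᵢ τ` induced on the inputs of `x ∘ᵢ y` when the inputs of `x` are permuted by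
`σ` and those of `y` by `τ`. -/
def blockPerm {m n l : ℕ} (i : Fin m) (h : m + n = l + 1) (σ : Perm (Fin m))
    (τ : Perm (Fin n)) : Perm (Fin l) :=
  (planar i h).symm.trans ((Equiv.sumCongr (σ.subtypeEquiv (fun x => by simp)) τ).trans
    (planar (σ i) h))

lemma planar_inl {m n l : ℕ} (i : Fin m) (h : m + n = l + 1) (x : {x : Fin m // x ≠ i}) :
    (planar i h (Sum.inl x) : ℕ) = if (x.1 : ℕ) < i then (x.1 : ℕ) else (x.1 : ℕ) + n - 1 := by
  simp only [planar, Equiv.ofBijective_apply, Sum.elim_inl]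
  split_ifs <;> rfl

lemma planar_inr {m n l : ℕ} (i : Fin m) (h : m + n = l + 1) (y : Fin n) :
    (planar i h (Sum.inr y) : ℕ) = i + y := rfl

lemma planar_inl_congr {m n l : ℕ} {i i' : Fin m} (h : m + n = l + 1) (hi : i = i')
    {x : {x : Fin m // x ≠ i}} {y : {x : Fin m // x ≠ i'}} (hxy : x.1 = y.1) :
    planar i h (Sum.inl x) = planar i' h (Sum.inl y) := by
  subst hi
  rw [Subtype.ext hxy]

lemma blockPerm_inl {m n l : ℕ} (i : Fin m) (h : m + n = l + 1) (σ : Perm (Fin m))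
    (τ : Perm (Fin n)) (x : {x : Fin m // x ≠ i}) :
    blockPerm i h σ τ (planar i h (Sum.inl x)) =
      planar (σ i) h (Sum.inl ⟨σ x.1, fun H => x.2 (σ.injective H)⟩) := by
  simp [blockPerm]

lemma blockPerm_inr {m n l : ℕ} (i : Fin m) (h : m + n = l + 1) (σ : Perm (Fin m))
    (τ : Perm (Fin n)) (y : Fin n) :
    blockPerm i h σ τ (planar i h (Sum.inr y)) = planar (σ i) h (Sum.inr (τ y)) := by
  simp [blockPerm]

lemma blockPerm_mul {m n l : ℕ} (i : Fin m) (h : m + n = l + 1) (σ σ' : Perm (Fin m))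
    (τ τ' : Perm (Fin n)) :
    blockPerm i h (σ' * σ) (τ' * τ) = blockPerm (σ i) h σ' τ' * blockPerm i h σ τ := by
  ext z : 1
  obtain ⟨x | y, rfl⟩ := (planar i h).surjective z
  · rw [Equiv.Perm.mul_apply, blockPerm_inl, blockPerm_inl, blockPerm_inl]; rfl
  · rw [Equiv.Perm.mul_apply, blockPerm_inr, blockPerm_inr, blockPerm_inr]; rfl

lemma sign_blockPerm_one {m n l : ℕ} (i : Fin m) (h : m + n = l + 1) (τ : Perm (Fin n)) :
    Equiv.Perm.sign (blockPerm i h 1 τ) = Equiv.Perm.sign τ := by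
  have h1 : blockPerm i h 1 τ =
      ((planar i h).symm.trans (Equiv.Perm.sumCongr 1 τ)).trans (planar i h) := by
    ext z : 1
    obtain ⟨x | y, rfl⟩ := (planar i h).surjective z
    · rw [blockPerm_inl]; simp; rfl
    · rw [blockPerm_inr]; simp; rfl
  rw [h1, Equiv.Perm.sign_symm_trans_trans, Equiv.Perm.sign_sumCongr, Equiv.Perm.sign_one, one_mul]

lemma sign_blockPerm_swap {m n l : ℕ} (a : ℕ) (ha : a + 1 < m) (h : m + n = l + 1) :
    Equiv.Perm.sign (blockPerm (⟨a, by omega⟩ : Fin m) h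
      (Equiv.swap ⟨a, by omega⟩ ⟨a + 1, ha⟩) (1 : Perm (Fin n))) = (-1) ^ n := by
  have hl : NeZero l := ⟨by omega⟩
  have h1 : blockPerm (⟨a, by omega⟩ : Fin m) h
      (Equiv.swap ⟨a, by omega⟩ ⟨a + 1, ha⟩) (1 : Perm (Fin n)) =
      Fin.cycleIcc (⟨a, by omega⟩ : Fin l) ⟨a + n, by omega⟩ := by
    have hs : (Equiv.swap (⟨a, by omega⟩ : Fin m) ⟨a + 1, ha⟩) ⟨a, by omega⟩ = ⟨a + 1, ha⟩ :=
      Equiv.swap_apply_left _ _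
    ext z : 1
    obtain ⟨x | y, rfl⟩ := (planar (⟨a, by omega⟩ : Fin m) h).surjective z
    · rw [blockPerm_inl]
      obtain ⟨x, hx⟩ := x
      have hx' : (x : ℕ) ≠ a := fun H => hx (Fin.ext H)
      rcases lt_or_gt_of_ne hx' with hlt | hgt
      · have hz : (planar (⟨a, by omega⟩ : Fin m) h (Sum.inl ⟨x, hx⟩) : ℕ) = x := by
          rw [planar_inl]; simp [hlt]
        rw [Fin.cycleIcc_of_lt (by rw [Fin.lt_def, hz]; exact hlt)]
        apply Fin.ext
        rw [hz, planar_inl]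
        simp only [hs]
        rw [Equiv.swap_apply_of_ne_of_ne hx (fun H => by
          have := congrArg Fin.val H; simp at this; omega)]
        rw [if_pos (by omega)]
      · by_cases hx1 : (x : ℕ) = a + 1
        · have hxx : x = ⟨a + 1, ha⟩ := Fin.ext hx1
          subst hxx
          have hz : planar (⟨a, by omega⟩ : Fin m) h (Sum.inl ⟨⟨a + 1, ha⟩, hx⟩) =
              ⟨a + n, by omega⟩ := by
            apply Fin.ext
            rw [planar_inl]; simp
            try omega
          rw [hz, Fin.cycleIcc_of_last (by simp [Fin.le_def])]
          apply Fin.ext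
          rw [planar_inl]
          simp only [hs, Equiv.swap_apply_right]
          simp
        · have hz : (planar (⟨a, by omega⟩ : Fin m) h (Sum.inl ⟨x, hx⟩) : ℕ) = x + n - 1 := by
            rw [planar_inl]; simp; omega
          rw [Fin.cycleIcc_of_gt (by rw [Fin.lt_def, hz]; simp; omega)]
          apply Fin.ext
          rw [hz, planar_inl]
          simp only [hs]
          rw [Equiv.swap_apply_of_ne_of_ne hx (fun H => hx1 (congrArg Fin.val H))]
          rw [if_neg (by omega)]
    · rw [blockPerm_inr]
      have hy := y.2
      rw [Fin.cycleIcc_of_ge_of_lt (by rw [Fin.le_def, planar_inr]; simp)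
        (by rw [Fin.lt_def, planar_inr]; simp)]
      apply Fin.ext
      rw [planar_inr, Fin.val_add_one_of_lt' (by rw [planar_inr]; simp; omega), planar_inr, hs]
      simp; omega
  rw [h1, Fin.sign_cycleIcc_of_le (by simp [Fin.le_def])]
  simp

/-- The sign of a block permutation. -/
lemma sign_blockPerm {m n l : ℕ} (i : Fin m) (h : m + n = l + 1) (σ : Perm (Fin m))
    (τ : Perm (Fin n)) :
    Equiv.Perm.sign (blockPerm i h σ τ) * (-1) ^ ((n + 1) * (i : ℕ)) =
      Equiv.Perm.sign σ * Equiv.Perm.sign τ * (-1) ^ ((n + 1) * (σ i : ℕ)) := by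
  have key : ∀ i : Fin m, Equiv.Perm.sign (blockPerm i h σ (1 : Perm (Fin n))) =
      Equiv.Perm.sign σ * (-1) ^ ((n + 1) * ((i : ℕ) + (σ i : ℕ))) := by
    obtain _ | m := m
    · exact fun i => i.elim0
    have hσ : σ ∈ Submonoid.closure
        (Set.range fun i : Fin m => Equiv.swap i.castSucc i.succ) := by
      rw [Equiv.Perm.mclosure_swap_castSucc_succ]; trivial
    induction hσ using Submonoid.closure_induction with
    | one =>
      intro i
      rw [sign_blockPerm_one]
      have : (n + 1) * ((i : ℕ) + ((1 : Perm (Fin (m + 1))) i : ℕ)) = 2 * ((n + 1) * i) := by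
        simp; ring
      rw [this, pow_mul]; simp
    | mul x y _ _ hx hy =>
      intro i
      have : blockPerm i h (x * y) (1 : Perm (Fin n)) =
          blockPerm (y i) h x 1 * blockPerm i h y 1 := by rw [← blockPerm_mul, one_mul]
      rw [this, map_mul, hx, hy, map_mul, Equiv.Perm.mul_apply]
      have : (n + 1) * ((y i : ℕ) + x (y i)) + (n + 1) * ((i : ℕ) + y i) =
          (n + 1) * ((i : ℕ) + x (y i)) + 2 * ((n + 1) * y i) := by ring
      rw [mul_mul_mul_comm, ← pow_add, this, pow_add, pow_mul (-1 : ℤˣ) 2]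
      simp
    | mem s hs =>
      obtain ⟨a, rfl⟩ := hs
      have ha := a.2
      have hinv : ∀ i : Fin (m + 1), Equiv.Perm.sign (blockPerm
          ((Equiv.swap a.castSucc a.succ) i) h (Equiv.swap a.castSucc a.succ)
            (1 : Perm (Fin n))) *
          Equiv.Perm.sign (blockPerm i h (Equiv.swap a.castSucc a.succ) (1 : Perm (Fin n))) = 1 := by
        intro i
        rw [← map_mul, ← blockPerm_mul, Equiv.swap_mul_self, one_mul, sign_blockPerm_one]
        simp
      have hbase := sign_blockPerm_swap (n := n) (a : ℕ) (by omega : (a : ℕ) + 1 < m + 1) h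
      have hbase' : Equiv.Perm.sign (blockPerm a.castSucc h (Equiv.swap a.castSucc a.succ)
          (1 : Perm (Fin n))) = (-1) ^ n := hbase
      have hneq : a.castSucc ≠ a.succ := fun H => by
        have := congrArg Fin.val H; simp at this
      have e1 : (n + 1) * ((a : ℕ) + (a + 1)) = 2 * ((n + 1) * a) + (n + 1) := by ring
      have e2 : (n + 1) * (((a : ℕ) + 1) + a) = 2 * ((n + 1) * a) + (n + 1) := by ring
      intro i
      rw [Equiv.Perm.sign_swap hneq]
      by_cases h1 : i = a.castSucc
      · subst h1
        rw [hbase', Equiv.swap_apply_left]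
        simp only [Fin.val_castSucc, Fin.val_succ]
        rw [e1, pow_add, pow_mul]
        simp [pow_succ]
      · by_cases h2 : i = a.succ
        · subst h2
          have := hinv a.succ
          rw [Equiv.swap_apply_right, hbase'] at this
          have h3 : Equiv.Perm.sign (blockPerm a.succ h (Equiv.swap a.castSucc a.succ)
            (1 : Perm (Fin n))) = (-1) ^ n := by
            exact mul_left_cancel (this.trans (Int.units_mul_self ((-1 : ℤˣ) ^ n)).symm)
          rw [h3, Equiv.swap_apply_right]
          simp only [Fin.val_castSucc, Fin.val_succ]
          rw [e2, pow_add, pow_mul]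
          simp [pow_succ]
        · rw [Equiv.swap_apply_of_ne_of_ne h1 h2]
          have e3 : (n + 1) * ((i : ℕ) + i) = 2 * ((n + 1) * i) := by ring
          rw [e3, pow_mul]
          simp only [even_two, Even.neg_pow, one_pow, mul_one]
          have hsi : (Equiv.swap a.castSucc a.succ) i = i := Equiv.swap_apply_of_ne_of_ne h1 h2
          have : blockPerm i h (Equiv.swap a.castSucc a.succ) (1 : Perm (Fin n)) =
              Equiv.swap (planar i h (Sum.inl ⟨a.castSucc, fun H => h1 H.symm⟩))
                (planar i h (Sum.inl ⟨a.succ, fun H => h2 H.symm⟩)) := by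
            ext z : 1
            obtain ⟨⟨x, hx⟩ | y, rfl⟩ := (planar i h).surjective z
            · rw [blockPerm_inl]
              by_cases hx1 : x = a.castSucc
              · subst hx1
                exact (planar_inl_congr h hsi (Equiv.swap_apply_left _ _)).trans
                  (Equiv.swap_apply_left _ _).symm
              · by_cases hx2 : x = a.succ
                · subst hx2
                  exact (planar_inl_congr h hsi (Equiv.swap_apply_right _ _)).trans
                    (Equiv.swap_apply_right _ _).symm
                · exact (planar_inl_congr h hsi (Equiv.swap_apply_of_ne_of_ne hx1 hx2)).trans
                    (Equiv.swap_apply_of_ne_of_ne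
                      (fun H => hx1 (by simpa using (planar i h).injective H))
                      (fun H => hx2 (by simpa using (planar i h).injective H))).symm
            · rw [blockPerm_inr]
              refine Eq.trans ?_ (Equiv.swap_apply_of_ne_of_ne
                (fun H => by simpa using (planar i h).injective H)
                (fun H => by simpa using (planar i h).injective H)).symm
              apply Fin.ext
              rw [planar_inr, planar_inr, hsi]; rfl
          rw [this, Equiv.Perm.sign_swap]
          exact fun H => hneq (by simpa using (planar i h).injective H)
  have hmul : blockPerm i h σ τ = blockPerm i h σ 1 * blockPerm i h 1 τ := by
    have := blockPerm_mul i h 1 σ τ 1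
    simpa using this
  rw [hmul, map_mul, key, sign_blockPerm_one]
  have : (n + 1) * ((i : ℕ) + (σ i : ℕ)) + (n + 1) * (i : ℕ) =
      2 * ((n + 1) * i) + (n + 1) * (σ i : ℕ) := by ring
  calc _ = Equiv.Perm.sign σ * Equiv.Perm.sign τ *
        ((-1) ^ ((n + 1) * ((i : ℕ) + (σ i : ℕ))) * (-1) ^ ((n + 1) * (i : ℕ))) := by
          simp only [mul_assoc, mul_comm]
    _ = _ := by rw [← pow_add, this, pow_add, pow_mul]; simp

/-- A graded `Σ`-module over `𝕜`: for every arity `a` and every degree `j` a vector space with a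
linear action of the symmetric group on `a` letters. -/
structure SigmaModule (𝕜 : Type u) [Field 𝕜] where
  /-- The component of arity `a` and degree `j`. -/
  carrier : ℕ → ℤ → Type u
  [grp : ∀ a j, AddCommGroup (carrier a j)]
  [mod : ∀ a j, Module 𝕜 (carrier a j)]
  /-- The action of the symmetric groups. -/
  act : ∀ a j, Representation 𝕜 (Perm (Fin a)) (carrier a j)

attribute [instance] SigmaModule.grp SigmaModule.mod

/-- A graded (symmetric, unital) operad over `𝕜`, given by its partial compositions `∘ᵢ`.
In `circ i h hd x y` the operation `x` has arity `m` and degree `p`, the operation `y` has arity `n`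
and degree `q`, and the composition `x ∘ᵢ y` has arity `l = m + n - 1` and degree `r = p + q`. -/
structure Operad (𝕜 : Type u) [Field 𝕜] extends SigmaModule 𝕜 where
  /-- The unit, of arity `1` and degree `0`. -/
  one : ∀ j : ℤ, j = 0 → carrier 1 j
  /-- The partial compositions. -/
  circ : ∀ {m n l : ℕ} {p q r : ℤ}, Fin m → m + n = l + 1 → p + q = r →
    (carrier m p →ₗ[𝕜] carrier n q →ₗ[𝕜] carrier l r)
  one_circ : ∀ {n : ℕ} {p q : ℤ} (i : Fin 1) (h : 1 + n = n + 1) (hd : p + q = q) (hp : p = 0)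
    (x : carrier n q), circ i h hd (one p hp) x = x
  circ_one : ∀ {m : ℕ} {p q : ℤ} (i : Fin m) (hd : p + q = p) (hq : q = 0)
    (x : carrier m p), circ i rfl hd x (one q hq) = x
  /-- Equivariance. -/
  circ_act : ∀ {m n l : ℕ} {p q r : ℤ} (i : Fin m) (h : m + n = l + 1) (hd : p + q = r)
    (σ : Perm (Fin m)) (τ : Perm (Fin n)) (x : carrier m p) (y : carrier n q),
    circ (σ i) h hd (act m p σ x) (act n q τ y) = act l r (blockPerm i h σ τ) (circ i h hd x y)
  /-- Sequential associativity: `(x ∘ᵢ y) ∘ᵢ₊ⱼ z = x ∘ᵢ (y ∘ⱼ z)`. -/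
  circ_seq : ∀ {m n l mn nl mnl : ℕ} {p q r pq qr pqr : ℤ} (i : Fin m) (j : Fin n) (i' : Fin mn)
    (h₁ : m + n = mn + 1) (h₂ : mn + l = mnl + 1) (h₃ : n + l = nl + 1) (h₄ : m + nl = mnl + 1)
    (d₁ : p + q = pq) (d₂ : pq + r = pqr) (d₃ : q + r = qr) (d₄ : p + qr = pqr)
    (_ : (i' : ℕ) = i + j) (x : carrier m p) (y : carrier n q) (z : carrier l r),
    circ i' h₂ d₂ (circ i h₁ d₁ x y) z = circ i h₄ d₄ x (circ j h₃ d₃ y z)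
  /-- Parallel associativity: `(x ∘ᵢ y) ∘ⱼ₊ₙ₋₁ z = ± (x ∘ⱼ z) ∘ᵢ y` for `i < j`, with the Koszul
  sign of the interchange of `y` and `z`. -/
  circ_par : ∀ {m n l mn ml mnl : ℕ} {p q r pq pr pqr : ℤ} (i j : Fin m) (j' : Fin mn)
    (i' : Fin ml) (h₁ : m + n = mn + 1) (h₂ : mn + l = mnl + 1) (h₃ : m + l = ml + 1)
    (h₄ : ml + n = mnl + 1)
    (d₁ : p + q = pq) (d₂ : pq + r = pqr) (d₃ : p + r = pr) (d₄ : pr + q = pqr)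
    (_ : (i : ℕ) < j) (_ : (j' : ℕ) + 1 = j + n) (_ : (i' : ℕ) = i)
    (x : carrier m p) (y : carrier n q) (z : carrier l r),
    circ j' h₂ d₂ (circ i h₁ d₁ x y) z =
      (-1 : 𝕜) ^ (q * r) • circ i' h₄ d₄ (circ j h₃ d₃ x z) y

section

variable {𝕜 : Type u} [Field 𝕜]

/-- The part of a `Σ`-module that lies in the arities and degrees with the property `c`. -/
def SigmaModule.restrict (M : SigmaModule 𝕜) (c : ℕ → ℤ → Prop) : SigmaModule 𝕜 where
  carrier a j := ({ carrier := {x | c a j ∨ x = 0}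
                    add_mem' := by
                      rintro x y (hx | rfl) (hy | rfl) <;> simp_all
                    zero_mem' := Or.inr rfl
                    smul_mem' := by
                      rintro r x (hx | rfl) <;> simp_all } : Submodule 𝕜 (M.carrier a j))
  act a j :=
    { toFun := fun σ => (M.act a j σ).restrict (by rintro x (hx | rfl) <;> simp_all)
      map_one' := by ext x; simp
      map_mul' := by intro σ τ; ext x; simp }

/-- An isomorphism of graded operads. -/
structure Operad.Iso (P Q : Operad 𝕜) where
  /-- The components of the isomorphism. -/
  toEquiv : ∀ a j, P.carrier a j ≃ₗ[𝕜] Q.carrier a j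
  map_one : ∀ j hj, toEquiv 1 j (P.one j hj) = Q.one j hj
  map_act : ∀ a j σ x, toEquiv a j (P.act a j σ x) = Q.act a j σ (toEquiv a j x)
  map_circ : ∀ {m n l : ℕ} {p q r : ℤ} (i : Fin m) (h : m + n = l + 1) (hd : p + q = r)
    (x : P.carrier m p) (y : P.carrier n q),
    toEquiv l r (P.circ i h hd x y) = Q.circ i h hd (toEquiv m p x) (toEquiv n q y)

lemma neg_one_zpow_congr {a b : ℤ} (c : ℤ) (h : a = b + 2 * c) :
    (-1 : 𝕜) ^ a = (-1 : 𝕜) ^ b := by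
  have h1 : (-1 : 𝕜) ≠ 0 := by simp
  rw [h, zpow_add₀ h1, zpow_mul]
  simp

lemma neg_one_zpow_mul (a b : ℤ) : (-1 : 𝕜) ^ a * (-1 : 𝕜) ^ b = (-1 : 𝕜) ^ (a + b) :=
  (zpow_add₀ (by simp) a b).symm

lemma suspend_degree {m n l : ℕ} {p q r : ℤ} (ε : ℤ) (h : m + n = l + 1) (hd : p + q = r) :
    (p - ε * (m - 1)) + (q - ε * (n - 1)) = r - ε * (l - 1) := by
  have h' : (m : ℤ) + n = l + 1 := by exact_mod_cast h
  linear_combination hd - ε * h'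

lemma sign_blockPerm_field {m n l : ℕ} (i : Fin m) (h : m + n = l + 1) (σ : Perm (Fin m))
    (τ : Perm (Fin n)) :
    (((Equiv.Perm.sign σ : ℤˣ) : ℤ) : 𝕜) * (((Equiv.Perm.sign τ : ℤˣ) : ℤ) : 𝕜) *
        (-1 : 𝕜) ^ ((σ i : ℤ) * ((n : ℤ) - 1)) =
      (((Equiv.Perm.sign (blockPerm i h σ τ) : ℤˣ) : ℤ) : 𝕜) *
        (-1 : 𝕜) ^ ((i : ℤ) * ((n : ℤ) - 1)) := by
  have h1 := congrArg (fun u : ℤˣ => ((u : ℤ) : 𝕜)) (sign_blockPerm i h σ τ)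
  simp only [Units.val_mul, Units.val_pow_eq_pow_val, Units.val_neg, Units.val_one, Int.cast_mul,
    Int.cast_pow, Int.cast_neg, Int.cast_one] at h1
  rw [← zpow_natCast, ← zpow_natCast] at h1
  rw [neg_one_zpow_congr (a := (σ i : ℤ) * ((n : ℤ) - 1)) (b := (((n + 1) * (σ i : ℕ) : ℕ) : ℤ))
      (-(σ i : ℤ)) (by push_cast; ring),
    neg_one_zpow_congr (a := (i : ℤ) * ((n : ℤ) - 1)) (b := (((n + 1) * (i : ℕ) : ℕ) : ℤ))
      (-(i : ℤ)) (by push_cast; ring)]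
  exact h1.symm

/-- The operadic suspension `s P` (for `ε = 1`) and its inverse `s⁻¹ P` (for `ε = -1`):
the component of arity `a` is shifted up by `ε (a - 1)` and tensored with the sign representation.
The composition carries the Koszul sign of moving the (de)suspension of the second operation past
the first operation, and the sign `(-1) ^ (i (n - 1))` of its `i`-th partial insertion
(`i = 0, 1, …`), as in the endomorphism operad of a one-dimensional vector space in degree `∓ 1`. -/
def Operad.suspend (P : Operad 𝕜) (ε : ℤˣ) : Operad 𝕜 where
  carrier a j := P.carrier a (j - ε * ((a : ℤ) - 1))
  act a j :=
    { toFun := fun σ =>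
        (((Equiv.Perm.sign σ : ℤˣ) : ℤ) : 𝕜) • P.act a (j - ε * ((a : ℤ) - 1)) σ
      map_one' := by simp
      map_mul' := by
        intro σ τ
        ext x
        simp only [Units.val_mul, Int.cast_mul, map_mul, Module.End.mul_apply,
          LinearMap.smul_apply, map_smul, smul_smul]
        congr 1
        exact mul_comm _ _ }
  one j hj := P.one _ (by simp [hj])
  circ {m n l p q r} i h hd :=
    (-1 : 𝕜) ^ ((p - ε * ((m : ℤ) - 1)) * ((n : ℤ) - 1) + (i : ℤ) * ((n : ℤ) - 1)) •
      P.circ i h (suspend_degree (ε : ℤ) h hd)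
  one_circ {n p q} i h hd hp x := by
    subst hp
    simp [P.one_circ]
  circ_one {m p q} i hd hq x := by
    simp [P.circ_one]
  circ_act {m n l p q r} i h hd σ τ x y := by
    simp only [MonoidHom.coe_mk, OneHom.coe_mk, LinearMap.smul_apply, map_smul, P.circ_act,
      smul_smul]
    congr 1
    simp only [← neg_one_zpow_mul]
    have := sign_blockPerm_field (𝕜 := 𝕜) i h σ τ
    linear_combination (-1 : 𝕜) ^ ((p - ε * ((m : ℤ) - 1)) * ((n : ℤ) - 1)) * this
  circ_seq {m n l mn nl mnl p q r pq qr pqr} i j i' h₁ h₂ h₃ h₄ d₁ d₂ d₃ d₄ hi x y z := by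
    simp only [LinearMap.smul_apply, map_smul, smul_smul, neg_one_zpow_mul]
    rw [P.circ_seq i j i' h₁ h₂ h₃ h₄ _ _ (suspend_degree (ε : ℤ) h₃ d₃)
      (suspend_degree (ε : ℤ) h₄ d₄) hi]
    congr 1
    have e1 : (mn : ℤ) = m + n - 1 := by have : (m : ℤ) + n = mn + 1 := by exact_mod_cast h₁
                                         linarith
    have e2 : (nl : ℤ) = n + l - 1 := by have : (n : ℤ) + l = nl + 1 := by exact_mod_cast h₃
                                         linarith
    have e3 : (i' : ℤ) = i + j := by exact_mod_cast hi
    subst d₁ d₃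
    rw [e1, e2, e3]
    apply neg_one_zpow_congr 0
    ring
  circ_par {m n l mn ml mnl p q r pq pr pqr} i j j' i' h₁ h₂ h₃ h₄ d₁ d₂ d₃ d₄ hij hj hi x y z := by
    simp only [LinearMap.smul_apply, map_smul, smul_smul, neg_one_zpow_mul]
    rw [P.circ_par i j j' i' h₁ h₂ h₃ h₄ _ _ (suspend_degree (ε : ℤ) h₃ d₃)
      (suspend_degree (ε : ℤ) h₄ d₄) hij hj hi, smul_smul, neg_one_zpow_mul]
    congr 1
    have e1 : (mn : ℤ) = m + n - 1 := by have : (m : ℤ) + n = mn + 1 := by exact_mod_cast h₁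
                                         linarith
    have e2 : (ml : ℤ) = m + l - 1 := by have : (m : ℤ) + l = ml + 1 := by exact_mod_cast h₃
                                         linarith
    have e3 : (i' : ℤ) = i := by exact_mod_cast hi
    have e4 : (j' : ℤ) = j + n - 1 := by have : (j' : ℤ) + 1 = j + n := by exact_mod_cast hj
                                         linarith
    subst d₁ d₃
    rw [e1, e2, e3, e4]
    rcases Int.units_eq_one_or ε with rfl | rfl
    · apply neg_one_zpow_congr (((n : ℤ) - 1) * (l - 1) - r * (n - 1))
      push_cast
      ring
    · apply neg_one_zpow_congr ((q + (n - 1)) * (l - 1))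
      push_cast
      ring

/-! ### Operadic ideals and quotients -/

/-- Membership in the operadic ideal generated by a family `R` of sets of operations. -/
inductive Operad.IdealMem (P : Operad 𝕜) (R : ∀ a j, Set (P.carrier a j)) :
    ∀ (a : ℕ) (j : ℤ), P.carrier a j → Prop
  | of {a j} (x : P.carrier a j) (hx : x ∈ R a j) : P.IdealMem R a j x
  | zero (a j) : P.IdealMem R a j 0
  | add {a j} (x y : P.carrier a j) : P.IdealMem R a j x → P.IdealMem R a j y →
      P.IdealMem R a j (x + y)
  | smul {a j} (c : 𝕜) (x : P.carrier a j) : P.IdealMem R a j x → P.IdealMem R a j (c • x)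
  | act {a j} (σ : Perm (Fin a)) (x : P.carrier a j) : P.IdealMem R a j x →
      P.IdealMem R a j (P.act a j σ x)
  | circ_left {m n l : ℕ} {p q r : ℤ} (i : Fin m) (h : m + n = l + 1) (hd : p + q = r)
      (x : P.carrier m p) (y : P.carrier n q) : P.IdealMem R m p x →
      P.IdealMem R l r (P.circ i h hd x y)
  | circ_right {m n l : ℕ} {p q r : ℤ} (i : Fin m) (h : m + n = l + 1) (hd : p + q = r)
      (x : P.carrier m p) (y : P.carrier n q) : P.IdealMem R n q y →
      P.IdealMem R l r (P.circ i h hd x y)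

/-- The operadic ideal generated by `R`. -/
def Operad.ideal (P : Operad 𝕜) (R : ∀ a j, Set (P.carrier a j)) (a : ℕ) (j : ℤ) :
    Submodule 𝕜 (P.carrier a j) where
  carrier := {x | P.IdealMem R a j x}
  add_mem' := fun hx hy => .add _ _ hx hy
  zero_mem' := .zero _ _
  smul_mem' := fun c _ hx => .smul c _ hx

/-- The quotient `P / (R)` of an operad by the operadic ideal generated by `R`. -/
def Operad.quotient (P : Operad 𝕜) (R : ∀ a j, Set (P.carrier a j)) : Operad 𝕜 where
  carrier a j := P.carrier a j ⧸ P.ideal R a j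
  act a j :=
    { toFun := fun σ => (P.ideal R a j).mapQ (P.ideal R a j) (P.act a j σ)
        (fun _ hx => .act σ _ hx)
      map_one' := by ext x; simp
      map_mul' := by intro σ τ; ext x; simp; rfl }
  one j hj := (P.ideal R 1 j).mkQ (P.one j hj)
  circ {m n l p q r} i h hd :=
    (P.ideal R m p).liftQ
      (((P.ideal R n q).mapQLinear (P.ideal R l r)).comp
        ((P.circ i h hd).codRestrict ((P.ideal R n q).compatibleMaps (P.ideal R l r))
          (fun x _ hy => .circ_right i h hd x _ hy)))
      (by
        intro x hx
        ext y
        simp only [LinearMap.coe_comp, Function.comp_apply, Submodule.mkQ_apply]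
        exact (Submodule.Quotient.mk_eq_zero _).mpr (.circ_left i h hd x y hx))
  one_circ i h hd hp x := by
    obtain ⟨x, rfl⟩ := Submodule.Quotient.mk_surjective _ x
    exact congrArg (Submodule.mkQ _) (P.one_circ i h hd hp x)
  circ_one i hd hq x := by
    obtain ⟨x, rfl⟩ := Submodule.Quotient.mk_surjective _ x
    exact congrArg (Submodule.mkQ _) (P.circ_one i hd hq x)
  circ_act i h hd σ τ x y := by
    obtain ⟨x, rfl⟩ := Submodule.Quotient.mk_surjective _ x
    obtain ⟨y, rfl⟩ := Submodule.Quotient.mk_surjective _ y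
    exact congrArg (Submodule.mkQ _) (P.circ_act i h hd σ τ x y)
  circ_seq i j i' h₁ h₂ h₃ h₄ d₁ d₂ d₃ d₄ hi x y z := by
    obtain ⟨x, rfl⟩ := Submodule.Quotient.mk_surjective _ x
    obtain ⟨y, rfl⟩ := Submodule.Quotient.mk_surjective _ y
    obtain ⟨z, rfl⟩ := Submodule.Quotient.mk_surjective _ z
    exact congrArg (Submodule.mkQ _) (P.circ_seq i j i' h₁ h₂ h₃ h₄ d₁ d₂ d₃ d₄ hi x y z)
  circ_par i j j' i' h₁ h₂ h₃ h₄ d₁ d₂ d₃ d₄ hij hj hi x y z := by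
    obtain ⟨x, rfl⟩ := Submodule.Quotient.mk_surjective _ x
    obtain ⟨y, rfl⟩ := Submodule.Quotient.mk_surjective _ y
    obtain ⟨z, rfl⟩ := Submodule.Quotient.mk_surjective _ z
    exact congrArg (Submodule.mkQ _)
      (P.circ_par i j j' i' h₁ h₂ h₃ h₄ d₁ d₂ d₃ d₄ hij hj hi x y z)

/-! ### The free operad -/

/-- Formal operadic expressions in the elements of a `Σ`-module `M`. -/
inductive FreePre (M : SigmaModule 𝕜) : ℕ → ℤ → Type u
  | gen {a : ℕ} {j : ℤ} (x : M.carrier a j) : FreePre M a j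
  | one (j : ℤ) (hj : j = 0) : FreePre M 1 j
  | circ {m n l : ℕ} {p q r : ℤ} (i : Fin m) (h : m + n = l + 1) (hd : p + q = r)
      (x : FreePre M m p) (y : FreePre M n q) : FreePre M l r
  | act {a : ℕ} {j : ℤ} (σ : Perm (Fin a)) (x : FreePre M a j) : FreePre M a j
  | zero (a : ℕ) (j : ℤ) : FreePre M a j
  | add {a : ℕ} {j : ℤ} (x y : FreePre M a j) : FreePre M a j
  | smul {a : ℕ} {j : ℤ} (c : 𝕜) (x : FreePre M a j) : FreePre M a j

open FreePre in
/-- The relations that hold between operadic expressions in every operad: compatibility with the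
structure of `M`, the axioms of a vector space, linearity, and the axioms of an operad. -/
inductive FreeRel (M : SigmaModule 𝕜) :
    ∀ {a : ℕ} {j : ℤ}, FreePre M a j → FreePre M a j → Prop
  | gen_add {a j} (x y : M.carrier a j) : FreeRel M (gen (x + y)) (add (gen x) (gen y))
  | gen_smul {a j} (c : 𝕜) (x : M.carrier a j) : FreeRel M (gen (c • x)) (smul c (gen x))
  | gen_act {a j} (σ : Perm (Fin a)) (x : M.carrier a j) :
      FreeRel M (gen (M.act a j σ x)) (act σ (gen x))
  | congr_circ_left {m n l : ℕ} {p q r : ℤ} (i : Fin m) (h : m + n = l + 1) (hd : p + q = r)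
      {x x' : FreePre M m p} (y : FreePre M n q) :
      FreeRel M x x' → FreeRel M (circ i h hd x y) (circ i h hd x' y)
  | congr_circ_right {m n l : ℕ} {p q r : ℤ} (i : Fin m) (h : m + n = l + 1) (hd : p + q = r)
      (x : FreePre M m p) {y y' : FreePre M n q} :
      FreeRel M y y' → FreeRel M (circ i h hd x y) (circ i h hd x y')
  | congr_act {a j} (σ : Perm (Fin a)) {x x' : FreePre M a j} :
      FreeRel M x x' → FreeRel M (act σ x) (act σ x')
  | congr_add_left {a j} {x x' : FreePre M a j} (y : FreePre M a j) :
      FreeRel M x x' → FreeRel M (add x y) (add x' y)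
  | congr_add_right {a j} (x : FreePre M a j) {y y' : FreePre M a j} :
      FreeRel M y y' → FreeRel M (add x y) (add x y')
  | congr_smul {a j} (c : 𝕜) {x x' : FreePre M a j} :
      FreeRel M x x' → FreeRel M (smul c x) (smul c x')
  | add_comm {a j} (x y : FreePre M a j) : FreeRel M (add x y) (add y x)
  | add_assoc {a j} (x y z : FreePre M a j) :
      FreeRel M (add (add x y) z) (add x (add y z))
  | zero_add {a j} (x : FreePre M a j) : FreeRel M (add (zero a j) x) x
  | zero_smul {a j} (x : FreePre M a j) : FreeRel M (smul 0 x) (zero a j)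
  | one_smul {a j} (x : FreePre M a j) : FreeRel M (smul 1 x) x
  | mul_smul {a j} (c d : 𝕜) (x : FreePre M a j) :
      FreeRel M (smul (c * d) x) (smul c (smul d x))
  | add_smul {a j} (c d : 𝕜) (x : FreePre M a j) :
      FreeRel M (smul (c + d) x) (add (smul c x) (smul d x))
  | smul_add {a j} (c : 𝕜) (x y : FreePre M a j) :
      FreeRel M (smul c (add x y)) (add (smul c x) (smul c y))
  | circ_add_left {m n l : ℕ} {p q r : ℤ} (i : Fin m) (h : m + n = l + 1) (hd : p + q = r)
      (x x' : FreePre M m p) (y : FreePre M n q) :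
      FreeRel M (circ i h hd (add x x') y) (add (circ i h hd x y) (circ i h hd x' y))
  | circ_smul_left {m n l : ℕ} {p q r : ℤ} (i : Fin m) (h : m + n = l + 1) (hd : p + q = r)
      (c : 𝕜) (x : FreePre M m p) (y : FreePre M n q) :
      FreeRel M (circ i h hd (smul c x) y) (smul c (circ i h hd x y))
  | circ_add_right {m n l : ℕ} {p q r : ℤ} (i : Fin m) (h : m + n = l + 1) (hd : p + q = r)
      (x : FreePre M m p) (y y' : FreePre M n q) :
      FreeRel M (circ i h hd x (add y y')) (add (circ i h hd x y) (circ i h hd x y'))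
  | circ_smul_right {m n l : ℕ} {p q r : ℤ} (i : Fin m) (h : m + n = l + 1) (hd : p + q = r)
      (c : 𝕜) (x : FreePre M m p) (y : FreePre M n q) :
      FreeRel M (circ i h hd x (smul c y)) (smul c (circ i h hd x y))
  | act_add {a j} (σ : Perm (Fin a)) (x y : FreePre M a j) :
      FreeRel M (act σ (add x y)) (add (act σ x) (act σ y))
  | act_smul {a j} (σ : Perm (Fin a)) (c : 𝕜) (x : FreePre M a j) :
      FreeRel M (act σ (smul c x)) (smul c (act σ x))
  | act_one {a j} (x : FreePre M a j) : FreeRel M (act 1 x) x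
  | act_mul {a j} (σ τ : Perm (Fin a)) (x : FreePre M a j) :
      FreeRel M (act (σ * τ) x) (act σ (act τ x))
  | one_circ {n : ℕ} {p q : ℤ} (i : Fin 1) (h : 1 + n = n + 1) (hd : p + q = q) (hp : p = 0)
      (x : FreePre M n q) : FreeRel M (circ i h hd (one p hp) x) x
  | circ_one {m : ℕ} {p q : ℤ} (i : Fin m) (hd : p + q = p) (hq : q = 0)
      (x : FreePre M m p) : FreeRel M (circ i rfl hd x (one q hq)) x
  | circ_act {m n l : ℕ} {p q r : ℤ} (i : Fin m) (h : m + n = l + 1) (hd : p + q = r)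
      (σ : Perm (Fin m)) (τ : Perm (Fin n)) (x : FreePre M m p) (y : FreePre M n q) :
      FreeRel M (circ (σ i) h hd (act σ x) (act τ y)) (act (blockPerm i h σ τ) (circ i h hd x y))
  | circ_seq {m n l mn nl mnl : ℕ} {p q r pq qr pqr : ℤ} (i : Fin m) (j : Fin n) (i' : Fin mn)
      (h₁ : m + n = mn + 1) (h₂ : mn + l = mnl + 1) (h₃ : n + l = nl + 1) (h₄ : m + nl = mnl + 1)
      (d₁ : p + q = pq) (d₂ : pq + r = pqr) (d₃ : q + r = qr) (d₄ : p + qr = pqr)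
      (_ : (i' : ℕ) = i + j) (x : FreePre M m p) (y : FreePre M n q) (z : FreePre M l r) :
      FreeRel M (circ i' h₂ d₂ (circ i h₁ d₁ x y) z) (circ i h₄ d₄ x (circ j h₃ d₃ y z))
  | circ_par {m n l mn ml mnl : ℕ} {p q r pq pr pqr : ℤ} (i j : Fin m) (j' : Fin mn)
      (i' : Fin ml) (h₁ : m + n = mn + 1) (h₂ : mn + l = mnl + 1) (h₃ : m + l = ml + 1)
      (h₄ : ml + n = mnl + 1)
      (d₁ : p + q = pq) (d₂ : pq + r = pqr) (d₃ : p + r = pr) (d₄ : pr + q = pqr)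
      (_ : (i : ℕ) < j) (_ : (j' : ℕ) + 1 = j + n) (_ : (i' : ℕ) = i)
      (x : FreePre M m p) (y : FreePre M n q) (z : FreePre M l r) :
      FreeRel M (circ j' h₂ d₂ (circ i h₁ d₁ x y) z)
        (smul ((-1 : 𝕜) ^ (q * r)) (circ i' h₄ d₄ (circ j h₃ d₃ x z) y))

/-- The components of the free operad on `M`. -/
def FreeCarrier (M : SigmaModule 𝕜) (a : ℕ) (j : ℤ) : Type u :=
  Quot (@FreeRel 𝕜 _ M a j)

/-- The class of an operadic expression. -/
def FreeCarrier.mk {M : SigmaModule 𝕜} {a : ℕ} {j : ℤ} (x : FreePre M a j) : FreeCarrier M a j :=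
  Quot.mk _ x

instance (M : SigmaModule 𝕜) (a : ℕ) (j : ℤ) : Add (FreeCarrier M a j) where
  add := Quot.map₂ FreePre.add (fun x _ _ h => .congr_add_right x h)
    (fun _ _ y h => .congr_add_left y h)

instance (M : SigmaModule 𝕜) (a : ℕ) (j : ℤ) : Zero (FreeCarrier M a j) where
  zero := .mk (.zero a j)

instance (M : SigmaModule 𝕜) (a : ℕ) (j : ℤ) : AddCommMonoid (FreeCarrier M a j) where
  add_assoc := by rintro ⟨x⟩ ⟨y⟩ ⟨z⟩; exact Quot.sound (.add_assoc x y z)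
  zero_add := by rintro ⟨x⟩; exact Quot.sound (.zero_add x)
  add_zero := by
    rintro ⟨x⟩
    exact (Quot.sound (.add_comm x _)).trans (Quot.sound (.zero_add x))
  add_comm := by rintro ⟨x⟩ ⟨y⟩; exact Quot.sound (.add_comm x y)
  nsmul := nsmulRec

instance (M : SigmaModule 𝕜) (a : ℕ) (j : ℤ) : Module 𝕜 (FreeCarrier M a j) where
  smul c := Quot.map (FreePre.smul c) (fun _ _ h => .congr_smul c h)
  one_smul := by rintro ⟨x⟩; exact Quot.sound (.one_smul x)
  mul_smul := by rintro c d ⟨x⟩; exact Quot.sound (.mul_smul c d x)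
  smul_zero := by
    intro c
    have h0 : (FreeCarrier.mk (.smul 0 (.zero a j)) : FreeCarrier M a j) = .mk (.zero a j) :=
      Quot.sound (.zero_smul _)
    have h1 : (FreeCarrier.mk (.smul (c * 0) (.zero a j)) : FreeCarrier M a j) =
        .mk (.smul c (.smul 0 (.zero a j))) := Quot.sound (.mul_smul c 0 _)
    have h2 : (FreeCarrier.mk (.smul c (.smul 0 (.zero a j))) : FreeCarrier M a j) =
        .mk (.smul c (.zero a j)) := Quot.sound (.congr_smul c (.zero_smul _))
    rw [mul_zero] at h1
    exact h2.symm.trans (h1.symm.trans h0)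
  smul_add := by rintro c ⟨x⟩ ⟨y⟩; exact Quot.sound (.smul_add c x y)
  add_smul := by rintro c d ⟨x⟩; exact Quot.sound (.add_smul c d x)
  zero_smul := by rintro ⟨x⟩; exact Quot.sound (.zero_smul x)

instance (M : SigmaModule 𝕜) (a : ℕ) (j : ℤ) : AddCommGroup (FreeCarrier M a j) :=
  Module.addCommMonoidToAddCommGroup 𝕜

/-- The free operad `Γ(M)` on a `Σ`-module `M`. -/
def free (M : SigmaModule 𝕜) : Operad 𝕜 where
  carrier := FreeCarrier M
  act a j :=
    { toFun := fun σ =>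
        { toFun := Quot.map (FreePre.act σ) (fun _ _ h => .congr_act σ h)
          map_add' := by rintro ⟨x⟩ ⟨y⟩; exact Quot.sound (.act_add σ x y)
          map_smul' := by rintro c ⟨x⟩; exact Quot.sound (.act_smul σ c x) }
      map_one' := by ext ⟨x⟩; exact Quot.sound (.act_one x)
      map_mul' := by intro σ τ; ext ⟨x⟩; exact Quot.sound (.act_mul σ τ x) }
  one j hj := .mk (.one j hj)
  circ i h hd := LinearMap.mk₂ 𝕜
    (Quot.map₂ (FreePre.circ i h hd) (fun x _ _ hy => .congr_circ_right i h hd x hy)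
      (fun _ _ y hx => .congr_circ_left i h hd y hx))
    (by rintro ⟨x⟩ ⟨x'⟩ ⟨y⟩; exact Quot.sound (.circ_add_left i h hd x x' y))
    (by rintro c ⟨x⟩ ⟨y⟩; exact Quot.sound (.circ_smul_left i h hd c x y))
    (by rintro ⟨x⟩ ⟨y⟩ ⟨y'⟩; exact Quot.sound (.circ_add_right i h hd x y y'))
    (by rintro c ⟨x⟩ ⟨y⟩; exact Quot.sound (.circ_smul_right i h hd c x y))
  one_circ i h hd hp := by rintro ⟨x⟩; exact Quot.sound (.one_circ i h hd hp x)
  circ_one i hd hq := by rintro ⟨x⟩; exact Quot.sound (.circ_one i hd hq x)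
  circ_act i h hd σ τ := by rintro ⟨x⟩ ⟨y⟩; exact Quot.sound (.circ_act i h hd σ τ x y)
  circ_seq i j i' h₁ h₂ h₃ h₄ d₁ d₂ d₃ d₄ hi := by
    rintro ⟨x⟩ ⟨y⟩ ⟨z⟩
    exact Quot.sound (.circ_seq i j i' h₁ h₂ h₃ h₄ d₁ d₂ d₃ d₄ hi x y z)
  circ_par i j j' i' h₁ h₂ h₃ h₄ d₁ d₂ d₃ d₄ hij hj hi := by
    rintro ⟨x⟩ ⟨y⟩ ⟨z⟩
    exact Quot.sound (.circ_par i j j' i' h₁ h₂ h₃ h₄ d₁ d₂ d₃ d₄ hij hj hi x y z)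

/-- The class of an operadic expression in the free operad. -/
def freeMk {M : SigmaModule 𝕜} {a : ℕ} {j : ℤ} (x : FreePre M a j) : (free M).carrier a j :=
  Quot.mk _ x

/-- The inclusion of the generators into the free operad. -/
def freeGen (M : SigmaModule 𝕜) (a : ℕ) (j : ℤ) : M.carrier a j →ₗ[𝕜] (free M).carrier a j where
  toFun x := freeMk (.gen x)
  map_add' x y := Quot.sound (.gen_add x y)
  map_smul' c x := Quot.sound (.gen_smul c x)

/-- The value of an operadic expression in an operad `P`, given values of the generators. -/
def FreePre.eval {M : SigmaModule 𝕜} (P : Operad 𝕜)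
    (f : ∀ a j, M.carrier a j →ₗ[𝕜] P.carrier a j) :
    ∀ {a : ℕ} {j : ℤ}, FreePre M a j → P.carrier a j
  | _, _, .gen x => f _ _ x
  | _, _, .one j hj => P.one j hj
  | _, _, .circ i h hd x y => P.circ i h hd (x.eval P f) (y.eval P f)
  | _, _, .act σ x => P.act _ _ σ (x.eval P f)
  | _, _, .zero _ _ => 0
  | _, _, .add x y => x.eval P f + y.eval P f
  | _, _, .smul c x => c • x.eval P f

lemma FreePre.eval_rel {M : SigmaModule 𝕜} (P : Operad 𝕜)
    (f : ∀ a j, M.carrier a j →ₗ[𝕜] P.carrier a j)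
    (hf : ∀ a j σ x, f a j (M.act a j σ x) = P.act a j σ (f a j x))
    {a : ℕ} {j : ℤ} {x y : FreePre M a j} (hxy : FreeRel M x y) : x.eval P f = y.eval P f := by
  induction hxy with
  | gen_act => simp [FreePre.eval, hf]
  | add_comm => simp only [FreePre.eval]; exact _root_.add_comm _ _
  | add_assoc => simp only [FreePre.eval]; exact _root_.add_assoc _ _ _
  | mul_smul => simp only [FreePre.eval]; exact (smul_smul _ _ _).symm
  | add_smul => simp only [FreePre.eval]; exact _root_.add_smul _ _ _
  | one_circ => simp only [FreePre.eval, P.one_circ]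
  | circ_one => simp only [FreePre.eval, P.circ_one]
  | circ_act => simp only [FreePre.eval, P.circ_act]
  | circ_seq i j i' h₁ h₂ h₃ h₄ d₁ d₂ d₃ d₄ hi x y z =>
    simp only [FreePre.eval]
    exact P.circ_seq i j i' h₁ h₂ h₃ h₄ d₁ d₂ d₃ d₄ hi _ _ _
  | circ_par i j j' i' h₁ h₂ h₃ h₄ d₁ d₂ d₃ d₄ hij hj hi x y z =>
    simp only [FreePre.eval]
    exact P.circ_par i j j' i' h₁ h₂ h₃ h₄ d₁ d₂ d₃ d₄ hij hj hi _ _ _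
  | _ => simp_all [FreePre.eval]

/-- The morphism of operads `Γ(M) → P` that extends an equivariant map `f : M → P`. -/
def freeLift {M : SigmaModule 𝕜} (P : Operad 𝕜) (f : ∀ a j, M.carrier a j →ₗ[𝕜] P.carrier a j)
    (hf : ∀ a j σ x, f a j (M.act a j σ x) = P.act a j σ (f a j x)) (a : ℕ) (j : ℤ) :
    (free M).carrier a j →ₗ[𝕜] P.carrier a j where
  toFun := Quot.lift (FreePre.eval P f) (fun _ _ h => FreePre.eval_rel P f hf h)
  map_add' := by rintro ⟨x⟩ ⟨y⟩; rfl
  map_smul' := by rintro c ⟨x⟩; rfl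

/-- The value at an operadic expression of the derivation with given values on generators. -/
def FreePre.deriv {M : SigmaModule 𝕜}
    (δ : ∀ a j, M.carrier a j →ₗ[𝕜] (free M).carrier a (j - 1)) :
    ∀ {a : ℕ} {j : ℤ}, FreePre M a j → (free M).carrier a (j - 1)
  | _, _, .gen x => δ _ _ x
  | _, _, .one _ _ => 0
  | _, _, .circ (p := p) i h hd x y =>
      (free M).circ i h (by omega) (x.deriv δ) (freeMk y) +
        (-1 : 𝕜) ^ p • (free M).circ i h (by omega) (freeMk x) (y.deriv δ)
  | _, _, .act σ x => (free M).act _ _ σ (x.deriv δ)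
  | _, _, .zero _ _ => 0
  | _, _, .add x y => x.deriv δ + y.deriv δ
  | _, _, .smul c x => c • x.deriv δ

section

variable {M : SigmaModule 𝕜} {a : ℕ} {j : ℤ}

lemma freeMk_eq {x y : FreePre M a j} (h : FreeRel M x y) : freeMk x = freeMk y :=
  Quot.sound h

lemma freeMk_add (x y : FreePre M a j) :
    freeMk (.add x y) = freeMk x + freeMk y := rfl

lemma freeMk_smul (c : 𝕜) (x : FreePre M a j) :
    freeMk (.smul c x) = c • freeMk x := rfl

lemma freeMk_zero : freeMk (.zero a j : FreePre M a j) = 0 := rfl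

lemma freeMk_act (σ : Perm (Fin a)) (x : FreePre M a j) :
    freeMk (.act σ x) = (free M).act a j σ (freeMk x) := rfl

lemma freeMk_one (hj : j = 0) :
    freeMk (.one j hj : FreePre M 1 j) = (free M).one j hj := rfl

lemma freeMk_circ {m n l : ℕ} {p q r : ℤ} (i : Fin m) (h : m + n = l + 1)
    (hd : p + q = r) (x : FreePre M m p) (y : FreePre M n q) :
    freeMk (.circ i h hd x y) =
      (free M).circ i h hd (freeMk x) (freeMk y) := rfl

end

lemma FreePre.deriv_rel {M : SigmaModule 𝕜}
    (δ : ∀ a j, M.carrier a j →ₗ[𝕜] (free M).carrier a (j - 1))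
    (hδ : ∀ a j σ x, δ a j (M.act a j σ x) = (free M).act a (j - 1) σ (δ a j x))
    {a : ℕ} {j : ℤ} {x y : FreePre M a j} (hxy : FreeRel M x y) : x.deriv δ = y.deriv δ := by
  induction hxy with
  | gen_act => simp only [FreePre.deriv, hδ]
  | gen_add => simp only [FreePre.deriv, map_add]
  | gen_smul => simp only [FreePre.deriv, map_smul]
  | congr_circ_left i h hd y hx ih =>
    have := freeMk_eq hx
    simp only [FreePre.deriv, ih, this]
  | congr_circ_right i h hd x hy ih =>
    have := freeMk_eq hy
    simp only [FreePre.deriv, ih, this]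
  | congr_act σ hx ih => simp only [FreePre.deriv, ih]
  | congr_add_left y hx ih => simp only [FreePre.deriv, ih]
  | congr_add_right x hx ih => simp only [FreePre.deriv, ih]
  | congr_smul c hx ih => simp only [FreePre.deriv, ih]
  | add_comm => simp only [FreePre.deriv]; exact _root_.add_comm _ _
  | add_assoc => simp only [FreePre.deriv]; exact _root_.add_assoc _ _ _
  | zero_add => simp only [FreePre.deriv]; exact _root_.zero_add _
  | zero_smul => simp only [FreePre.deriv]; exact _root_.zero_smul _ _
  | one_smul => simp only [FreePre.deriv]; exact _root_.one_smul _ _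
  | mul_smul => simp only [FreePre.deriv]; exact (smul_smul _ _ _).symm
  | add_smul => simp only [FreePre.deriv]; exact _root_.add_smul _ _ _
  | smul_add => simp only [FreePre.deriv]; exact _root_.smul_add _ _ _
  | circ_add_left i h hd x x' y =>
    simp only [FreePre.deriv, freeMk_add, map_add, LinearMap.add_apply, _root_.smul_add]
    abel
  | circ_smul_left i h hd c x y =>
    simp only [FreePre.deriv, freeMk_smul, map_smul, LinearMap.smul_apply,
      _root_.smul_add, smul_smul, mul_comm]
  | circ_add_right i h hd x y y' =>
    simp only [FreePre.deriv, freeMk_add, map_add, _root_.smul_add]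
    abel
  | circ_smul_right i h hd c x y =>
    simp only [FreePre.deriv, freeMk_smul, map_smul,
      _root_.smul_add, smul_smul, mul_comm]
  | act_add => simp only [FreePre.deriv, map_add]
  | act_smul => simp only [FreePre.deriv, map_smul]
  | act_one => simp only [FreePre.deriv, map_one, Module.End.one_apply]
  | act_mul => simp only [FreePre.deriv, map_mul, Module.End.mul_apply]
  | one_circ i h hd hp x =>
    subst hp
    simp only [FreePre.deriv, freeMk_one, (free M).one_circ, map_zero,
      LinearMap.zero_apply, _root_.zero_add, zpow_zero, _root_.one_smul]
  | circ_one i hd hq x =>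
    simp only [FreePre.deriv, freeMk_one, (free M).circ_one, map_zero,
      smul_zero, add_zero]
  | circ_act i h hd σ τ x y =>
    simp only [FreePre.deriv, freeMk_act, (free M).circ_act, map_add, map_smul]
  | @circ_seq m n l mn nl mnl p q r pq qr pqr i j i' h₁ h₂ h₃ h₄ d₁ d₂ d₃ d₄ hi x y z =>
    simp only [FreePre.deriv, freeMk_circ, map_add, map_smul, LinearMap.add_apply,
      LinearMap.smul_apply, _root_.smul_add, smul_smul, neg_one_zpow_mul]
    rw [(free M).circ_seq (qr := qr) i j i' h₁ h₂ h₃ h₄ _ _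
        (by omega) (by omega) hi,
      (free M).circ_seq (qr := qr - 1) i j i' h₁ h₂ h₃ h₄ _ _
        (by omega) (by omega) hi,
      (free M).circ_seq (qr := qr - 1) i j i' h₁ h₂ h₃ h₄ _ _
        (by omega) (by omega) hi, _root_.add_assoc, d₁]
  | @circ_par m n l mn ml mnl p q r pq pr pqr i j j' i' h₁ h₂ h₃ h₄ d₁ d₂ d₃ d₄ hij hj hi x y z =>
    simp only [FreePre.deriv, freeMk_circ, map_add, map_smul, LinearMap.add_apply,
      LinearMap.smul_apply, _root_.smul_add, smul_smul, neg_one_zpow_mul]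
    rw [(free M).circ_par (pr := pr - 1) i j j' i' h₁ h₂ h₃ h₄ _ _
        (by omega) (by omega) hij hj hi,
      (free M).circ_par (pr := pr) i j j' i' h₁ h₂ h₃ h₄ _ _
        (by omega) (by omega) hij hj hi,
      (free M).circ_par (pr := pr - 1) i j j' i' h₁ h₂ h₃ h₄ _ _
        (by omega) (by omega) hij hj hi]
    simp only [smul_smul, neg_one_zpow_mul]
    rw [neg_one_zpow_congr (𝕜 := 𝕜) (a := p + (q - 1) * r) (b := q * r + pr) (-r)
        (by subst d₃; ring),
      neg_one_zpow_congr (𝕜 := 𝕜) (a := pq + q * (r - 1)) (b := q * r + p) 0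
        (by subst d₁; ring)]
    abel

/-- The derivation of degree `-1` of the free operad `Γ(M)` that extends an equivariant map
`δ : M → Γ(M)` of degree `-1`. -/
def freeDeriv {M : SigmaModule 𝕜} (δ : ∀ a j, M.carrier a j →ₗ[𝕜] (free M).carrier a (j - 1))
    (hδ : ∀ a j σ x, δ a j (M.act a j σ x) = (free M).act a (j - 1) σ (δ a j x))
    (a : ℕ) (j : ℤ) : (free M).carrier a j →ₗ[𝕜] (free M).carrier a (j - 1) where
  toFun := Quot.lift (FreePre.deriv δ) (fun _ _ h => FreePre.deriv_rel δ hδ h)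
  map_add' := by rintro ⟨x⟩ ⟨y⟩; rfl
  map_smul' := by rintro c ⟨x⟩; rfl

/-! ### The dual bar construction -/

/-- The component-wise desuspension `↓ Q^#` of the linear dual of `Q`: its component of degree `j` is
the linear dual of the component of `Q` of degree `-(j + 1)`, with the contragredient action. -/
def Operad.desuspendDual (Q : Operad 𝕜) : SigmaModule 𝕜 where
  carrier a j := Module.Dual 𝕜 (Q.carrier a (-(j + 1)))
  act a j := (Q.act a (-(j + 1))).dual

/-- Evaluation of the elements of `↓ Q^#` at an operation of `Q`. -/
def Operad.evalAt (Q : Operad 𝕜) (a : ℕ) (j : ℤ) (x : Q.carrier a (-(j + 1))) :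
    Q.desuspendDual.carrier a j →ₗ[𝕜] 𝕜 :=
  Module.Dual.eval 𝕜 (Q.carrier a (-(j + 1))) x

lemma Operad.evalAt_act (Q : Operad 𝕜) (a : ℕ) (j : ℤ) (σ : Perm (Fin a))
    (x : Q.carrier a (-(j + 1))) (φ : Q.desuspendDual.carrier a j) :
    Q.evalAt a j x (Q.desuspendDual.act a j σ φ) =
      Q.evalAt a j (Q.act a (-(j + 1)) σ⁻¹ x) φ := rfl

/-- The generators `↓ \overline{s P^#}` of the dual bar construction of `P`. The cooperadic suspension
`s P^#` is the linear dual of `s⁻¹ P`. The operads `P` to which this is applied have no operations of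
arity `0`, and only the multiples of the unit in arity `1`, so that passing to the coaugmentation
coideal amounts to omitting the arities smaller than `2`. -/
def Operad.dualBarGen (P : Operad 𝕜) : SigmaModule 𝕜 :=
  (P.suspend (-1)).desuspendDual.restrict (fun a _ => 2 ≤ a)

open Classical in
/-- The projection of a `Σ`-module onto its part with the property `c`. -/
def SigmaModule.proj (M : SigmaModule 𝕜) (c : ℕ → ℤ → Prop) (a : ℕ) (j : ℤ) :
    M.carrier a j →ₗ[𝕜] (M.restrict c).carrier a j :=
  if h : c a j then LinearMap.codRestrict _ LinearMap.id (fun _ => Or.inl h) else 0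

/-- The inclusion of the part with the property `c` into a `Σ`-module. -/
def SigmaModule.incl (M : SigmaModule 𝕜) (c : ℕ → ℤ → Prop) (a : ℕ) (j : ℤ) :
    (M.restrict c).carrier a j →ₗ[𝕜] M.carrier a j :=
  Submodule.subtype _

/-- The inclusion of the generators of the dual bar construction into `↓ s P^#`. -/
def Operad.dualBarIncl (P : Operad 𝕜) (a : ℕ) (j : ℤ) :
    P.dualBarGen.carrier a j →ₗ[𝕜] (P.suspend (-1)).desuspendDual.carrier a j :=
  SigmaModule.incl _ _ a j

/-- The projection of `↓ s P^#` onto the generators of the dual bar construction. -/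
def Operad.dualBarProj (P : Operad 𝕜) (a : ℕ) (j : ℤ) :
    (P.suspend (-1)).desuspendDual.carrier a j →ₗ[𝕜] P.dualBarGen.carrier a j :=
  SigmaModule.proj _ _ a j

lemma Operad.dualBarIncl_act (P : Operad 𝕜) (a : ℕ) (j : ℤ) (σ : Perm (Fin a))
    (x : P.dualBarGen.carrier a j) :
    P.dualBarIncl a j (P.dualBarGen.act a j σ x) =
      (P.suspend (-1)).desuspendDual.act a j σ (P.dualBarIncl a j x) := rfl

open Classical in
/-- For finite-dimensional `V` and `W`, the identification of the dual of `V ⊗ W` with the tensor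
product of the duals, where `f ⊗ g` corresponds to `v ⊗ w ↦ f v * g w`. -/
def dualSplit (V W : Type u) [AddCommGroup V] [Module 𝕜 V] [AddCommGroup W] [Module 𝕜 W] :
    Module.Dual 𝕜 (TensorProduct 𝕜 V W) →ₗ[𝕜]
      TensorProduct 𝕜 (Module.Dual 𝕜 V) (Module.Dual 𝕜 W) :=
  if h : Module.Finite 𝕜 V ∧ Module.Finite 𝕜 W then
    haveI := h.1
    haveI := h.2
    (TensorProduct.dualDistribEquiv 𝕜 V W).symm.toLinearMap
  else 0

/-- The part of the cobar differential of `φ` that is dual to the partial composition `∘ᵢ` of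
`Q = s⁻¹ P` on operations of degrees `p = -(j₁ + 1)` and `q = -(j₂ + 1)`. In terms of homogeneous bases
it is `∑ (-1) ^ (p + p q) φ(x ∘ᵢ y) (x^# ∘ᵢ y^#)`, the sum being over the basis elements `x` of degree
`p` and `y` of degree `q`. The sign is the Koszul sign of the pairing of `x^# ⊗ y^#` with `x ⊗ y` and
of moving the second desuspension past `x^#`. -/
def Operad.dualBarTerm (P : Operad 𝕜) {m n a : ℕ} {j₁ j₂ j : ℤ} (i : Fin m) (h : m + n = a + 1)
    (hd : j₁ + j₂ = j - 1) :
    (P.suspend (-1)).desuspendDual.carrier a j →ₗ[𝕜] (free P.dualBarGen).carrier a (j - 1) :=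
  (-1 : 𝕜) ^ ((j₁ + 1) * j₂) •
    (TensorProduct.lift (((free P.dualBarGen).circ i h hd).compl₁₂
        ((freeGen P.dualBarGen m j₁).comp (P.dualBarProj m j₁))
        ((freeGen P.dualBarGen n j₂).comp (P.dualBarProj n j₂)))).comp
    ((dualSplit ((P.suspend (-1)).carrier m (-(j₁ + 1)))
        ((P.suspend (-1)).carrier n (-(j₂ + 1)))).comp
      (Module.Dual.transpose (TensorProduct.lift
        ((P.suspend (-1)).circ i h
          (show -(j₁ + 1) + -(j₂ + 1) = -(j + 1) by omega)))))

/-- The differential of the dual bar construction on generators. It is the sum over all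
decompositions of an operation into two, i.e. over all trees with two vertices and with labelled
inputs. Such a tree is obtained from `m! n!` pairs `(i, σ)`, where the first vertex has `m` inputs,
the second one has `n` inputs and is grafted to the input `i` of the first one, and `σ` permutes the
inputs. For given arities the sum over `j₁` has finitely many non-zero terms if the components of
`P` are of finite total dimension. -/
def Operad.dualBarDiffGen (P : Operad 𝕜) (a : ℕ) (j : ℤ) :
    P.dualBarGen.carrier a j →ₗ[𝕜] (free P.dualBarGen).carrier a (j - 1) :=
  ∑ mn : {mn : ℕ × ℕ // mn ∈ Finset.HasAntidiagonal.antidiagonal (a + 1)},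
    ((mn.1.1.factorial * mn.1.2.factorial : ℕ) : 𝕜)⁻¹ •
      ∑ i : Fin mn.1.1, ∑ σ : Perm (Fin a),
        ((free P.dualBarGen).act a (j - 1) σ).comp
          ((∑ᶠ j₁ : ℤ, P.dualBarTerm (j₁ := j₁) (j₂ := j - 1 - j₁) i
              (Finset.HasAntidiagonal.mem_antidiagonal.mp mn.2) (by omega)).comp
            (((P.suspend (-1)).desuspendDual.act a j σ⁻¹).comp (P.dualBarIncl a j)))

lemma Operad.dualBarDiffGen_act (P : Operad 𝕜) (a : ℕ) (j : ℤ) (τ : Perm (Fin a))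
    (x : P.dualBarGen.carrier a j) :
    P.dualBarDiffGen a j (P.dualBarGen.act a j τ x) =
      (free P.dualBarGen).act a (j - 1) τ (P.dualBarDiffGen a j x) := by
  simp only [Operad.dualBarDiffGen, LinearMap.sum_apply, LinearMap.smul_apply, map_sum, map_smul]
  refine Finset.sum_congr rfl fun mn _ => ?_
  congr 1
  refine Finset.sum_congr rfl fun i _ => ?_
  rw [← Equiv.sum_comp (Equiv.mulLeft τ)]
  refine Finset.sum_congr rfl fun σ _ => ?_
  have h2 : (P.suspend (-1)).desuspendDual.act a j (τ * σ)⁻¹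
      ((P.suspend (-1)).desuspendDual.act a j τ (P.dualBarIncl a j x)) =
      (P.suspend (-1)).desuspendDual.act a j σ⁻¹ (P.dualBarIncl a j x) := by
    rw [← Module.End.mul_apply, ← map_mul]
    congr 2
    simp
  simp only [LinearMap.comp_apply, Equiv.coe_mulLeft, Operad.dualBarIncl_act, h2]
  rw [map_mul, Module.End.mul_apply]

/-- The underlying graded operad of the dual bar construction `D(P)`. -/
def Operad.dualBar (P : Operad 𝕜) : Operad 𝕜 :=
  free P.dualBarGen

/-- The differential of the dual bar construction `D(P)`. -/
def Operad.dualBarDiff (P : Operad 𝕜) (a : ℕ) (j : ℤ) :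
    P.dualBar.carrier a j →ₗ[𝕜] P.dualBar.carrier a (j - 1) :=
  freeDeriv P.dualBarDiffGen P.dualBarDiffGen_act a j

/-! ### Quadratic operads generated by one operation without symmetry -/

/-- The `Σ`-module whose components are all regular representations. -/
def regularModule (𝕜 : Type u) [Field 𝕜] : SigmaModule 𝕜 where
  carrier a _ := MonoidAlgebra 𝕜 (Perm (Fin a))
  act a _ := Representation.leftRegular 𝕜 (Perm (Fin a))

/-- The `Σ`-module `E_μ`, the regular representation in arity `n` and degree `d`. -/
def oneGen (𝕜 : Type u) [Field 𝕜] (n : ℕ) (d : ℤ) : SigmaModule 𝕜 :=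
  (regularModule 𝕜).restrict (fun a j => a = n ∧ j = d)

/-- The generator `μ` of `E_μ`. -/
def oneGenElem (𝕜 : Type u) [Field 𝕜] (n : ℕ) (d : ℤ) (a : ℕ) (j : ℤ) (h : a = n ∧ j = d) :
    (oneGen 𝕜 n d).carrier a j :=
  ⟨(MonoidAlgebra.single 1 1 : MonoidAlgebra 𝕜 (Perm (Fin a))), Or.inl h⟩

/-- Coordinates of the elements of `Γ(μ)(2n - 1)` with respect to the basis `σ (μ ∘ᵢ μ)`. -/
abbrev QuadCoord (𝕜 : Type u) (n : ℕ) : Type u :=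
  Fin n × Perm (Fin (2 * n - 1)) → 𝕜

/-- The element of `Γ(μ)(2n - 1)` with given coordinates. -/
def quadElem (n : ℕ) (d : ℤ) (r : QuadCoord 𝕜 n) :
    (free (oneGen 𝕜 n d)).carrier (2 * n - 1) (2 * d) :=
  ∑ i : Fin n, ∑ σ : Perm (Fin (2 * n - 1)), r (i, σ) •
    (free (oneGen 𝕜 n d)).act _ _ σ
      ((free (oneGen 𝕜 n d)).circ i (by have := i.2; omega) (by omega)
        (freeGen _ n d (oneGenElem 𝕜 n d n d ⟨rfl, rfl⟩))
        (freeGen _ n d (oneGenElem 𝕜 n d n d ⟨rfl, rfl⟩)))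

/-- The relations of a quadratic operad as elements of the free operad `Γ(μ)`. -/
inductive QuadSet (n : ℕ) (d : ℤ) (R : Set (QuadCoord 𝕜 n)) :
    ∀ (a : ℕ) (j : ℤ), (free (oneGen 𝕜 n d)).carrier a j → Prop
  | intro (r : QuadCoord 𝕜 n) (hr : r ∈ R) : QuadSet n d R (2 * n - 1) (2 * d) (quadElem n d r)

/-- The quadratic operad `Γ(μ)/(R)` with one generating operation `μ` of arity `n` and degree `d`. -/
def quadratic (n : ℕ) (d : ℤ) (R : Set (QuadCoord 𝕜 n)) : Operad 𝕜 :=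
  (free (oneGen 𝕜 n d)).quotient (fun a j => {x | QuadSet n d R a j x})

/-- The generator `μ` of a quadratic operad. -/
def quadGen (n : ℕ) (d : ℤ) (R : Set (QuadCoord 𝕜 n)) (a : ℕ) (j : ℤ) (h : a = n ∧ j = d) :
    (quadratic n d R).carrier a j :=
  Submodule.mkQ _ (freeGen _ a j (oneGenElem 𝕜 n d a j h))

/-- The annihilator of the `Σ`-module of relations generated by `R`. The `Σ`-module
`E_μ^∨ = sgn ⊗ ↑ⁿ⁻² E_μ^#` is the regular representation generated by the suspension `μ^∨` of the element
of the basis dual to `{σ μ}` that corresponds to `μ`. In terms of the bases `σ (μ^∨ ∘ᵢ μ^∨)` and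
`σ (μ ∘ᵢ μ)`, the pairing is diagonal with the entries `(-1) ^ (i (n + 1)) sgn σ`,
`i = 0, …, n - 1`. -/
def quadPerp (n : ℕ) (R : Set (QuadCoord 𝕜 n)) : Set (QuadCoord 𝕜 n) :=
  {s | ∀ r ∈ R, ∀ τ : Perm (Fin (2 * n - 1)),
    ∑ i : Fin n, ∑ σ : Perm (Fin (2 * n - 1)),
      (-1 : 𝕜) ^ ((i : ℕ) * (n + 1)) * (((Equiv.Perm.sign σ : ℤˣ) : ℤ) : 𝕜) *
        (s (i, σ) * r (i, τ⁻¹ * σ)) = 0}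

/-- The Koszul dual `(Γ(μ)/(R))^! = Γ(μ^∨)/(R^⊥)`. -/
def quadDual (n : ℕ) (d : ℤ) (R : Set (QuadCoord 𝕜 n)) : Operad 𝕜 :=
  quadratic n (-d + n - 2) (quadPerp n R)

/-- The generator `μ^∨` of the Koszul dual, as an element of its desuspension. -/
def quadDualGen (n : ℕ) (d : ℤ) (R : Set (QuadCoord 𝕜 n)) (a : ℕ) (j : ℤ) (h : a = n ∧ j = d) :
    ((quadDual n d R).suspend (-1)).carrier a (-(j + 1)) :=
  quadGen n (-d + n - 2) (quadPerp n R) a _ ⟨h.1, by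
    obtain ⟨rfl, rfl⟩ := h
    push_cast
    ring⟩

open Classical in
/-- The natural map `D(P^!) → P` on generators: in arity `n` it is the canonical isomorphism
`↓ s E_μ^∨^# ≅ E_μ`, i.e. `φ ↦ ∑ φ(σ μ^∨) σ μ`, the sum being over all permutations `σ`, which act on
`μ^∨` as an element of `s⁻¹ P^!`. In the other arities it is zero. -/
def naturalGen (n : ℕ) (d : ℤ) (R : Set (QuadCoord 𝕜 n)) (a : ℕ) (j : ℤ) :
    (quadDual n d R).dualBarGen.carrier a j →ₗ[𝕜] (quadratic n d R).carrier a j :=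
  if h : a = n ∧ j = d then
    ∑ σ : Perm (Fin a),
      ((((quadDual n d R).suspend (-1)).evalAt a j
          (((quadDual n d R).suspend (-1)).act a (-(j + 1)) σ (quadDualGen n d R a j h))).comp
        ((quadDual n d R).dualBarIncl a j)).smulRight
        ((quadratic n d R).act a j σ (quadGen n d R a j h))
  else 0

lemma naturalGen_act (n : ℕ) (d : ℤ) (R : Set (QuadCoord 𝕜 n)) (a : ℕ) (j : ℤ) (τ : Perm (Fin a))
    (x : (quadDual n d R).dualBarGen.carrier a j) :
    naturalGen n d R a j ((quadDual n d R).dualBarGen.act a j τ x) =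
      (quadratic n d R).act a j τ (naturalGen n d R a j x) := by
  unfold naturalGen
  split_ifs with h
  · simp only [LinearMap.sum_apply, map_sum]
    rw [← Equiv.sum_comp (Equiv.mulLeft τ)]
    refine Finset.sum_congr rfl fun σ _ => ?_
    simp only [LinearMap.smulRight_apply, LinearMap.comp_apply, Equiv.coe_mulLeft, map_smul]
    rw [map_mul ((quadratic n d R).act a j), Module.End.mul_apply]
    congr 1
    rw [Operad.dualBarIncl_act, Operad.evalAt_act, ← Module.End.mul_apply, ← map_mul, inv_mul_cancel_left]
  · simp

/-- The natural map `D(P^!) → P` for a quadratic operad `P`. -/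
def naturalMap (n : ℕ) (d : ℤ) (R : Set (QuadCoord 𝕜 n)) (a : ℕ) (j : ℤ) :
    (quadDual n d R).dualBar.carrier a j →ₗ[𝕜] (quadratic n d R).carrier a j :=
  freeLift _ (naturalGen n d R) (naturalGen_act n d R) a j

/-- A quadratic operad `Q` with one generating operation of arity `n`, without symmetry, is Koszul:
for a quadratic presentation `P = Γ(μ)/(R)` of `Q`, the natural map `D(P^!) → P` is a homology
equivalence, where `P` has the zero differential. That is, every operation in `P` is the value of a
cycle, and every cycle of value zero is a boundary. -/
def IsKoszul (n : ℕ) (Q : Operad 𝕜) : Prop :=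
  ∃ (d : ℤ) (R : Set (QuadCoord 𝕜 n)), Nonempty (Operad.Iso (quadratic n d R) Q) ∧
    ∀ (a : ℕ) (j : ℤ),
      (∀ y : (quadratic n d R).carrier a j, ∃ z : (quadDual n d R).dualBar.carrier a j,
        (quadDual n d R).dualBarDiff a j z = 0 ∧ naturalMap n d R a j z = y) ∧
      (∀ z : (quadDual n d R).dualBar.carrier a (j - 1),
        (quadDual n d R).dualBarDiff a (j - 1) z = 0 → naturalMap n d R a (j - 1) z = 0 →
          ∃ w : (quadDual n d R).dualBar.carrier a j, (quadDual n d R).dualBarDiff a j w = z)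

/-! ### The four families -/

/-- The operad `tAss^n_d` for totally associative `n`-ary algebras with operation in degree `d`. -/
def tAss (𝕜 : Type u) [Field 𝕜] (n : ℕ) (d : ℤ) : Operad 𝕜 :=
  quadratic n d {r : QuadCoord 𝕜 n | ∃ i j : Fin n, r = Pi.single (i, 1) 1 - Pi.single (j, 1) 1}

/-- The operad `pAss^n_d` for partially associative `n`-ary algebras with operation in degree `d`. -/
def pAss (𝕜 : Type u) [Field 𝕜] (n : ℕ) (d : ℤ) : Operad 𝕜 :=
  quadratic n d
    {∑ i : Fin n, (-1 : 𝕜) ^ ((i : ℕ) * (n - 1)) • (Pi.single (i, 1) 1 : QuadCoord 𝕜 n)}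

/-- The operad `s tAss^n_{d-n+1}`. -/
def tAssTilde (𝕜 : Type u) [Field 𝕜] (n : ℕ) (d : ℤ) : Operad 𝕜 :=
  (tAss 𝕜 n (d - n + 1)).suspend 1

/-- The operad `s⁻¹ pAss^n_{d+n-1}`. -/
def pAssTilde (𝕜 : Type u) [Field 𝕜] (n : ℕ) (d : ℤ) : Operad 𝕜 :=
  (pAss 𝕜 n (d + n - 1)).suspend (-1)

end

end Operads

end

noncomputable section

namespace Operads

open Equiv (Perm)

universe u

/-! A composite of `k` copies of the generator `μ` has arity `1 + k(n-1)`, so for `n ≥ 2` the number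
of copies can be read off from the arity. For an even integer `c`, moving every operation of arity
`1 + k(n-1)` by `ck` in degree is therefore a rule depending on the arity alone, and it is additive
under partial composition. It turns an operation of degree `d` into one of degree `d + c`. Degrees
enter the operad axioms, the suspension, the Koszul dual and the dual bar construction only as
bookkeeping and through signs that depend on parities. Hence an even regrading commutes with all of
these constructions.

The proof makes this precise with `Operad.ShiftIso G P Q`, an isomorphism of `P`, regraded by `G`,
with `Q`. Such isomorphisms pass to free operads (`SigmaModule.ShiftIso.freeIso`), to quotients
(`Operad.ShiftIso.quotient`) and to suspensions (`Operad.ShiftIso.suspend`). Thus the same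
coordinate relations imposed on generators of degrees `d` and `d + G.shift n` give operads that
agree up to `G` (`quadraticIso`).

The generator of the Koszul dual has degree `-d + n - 2`, so the duals agree up to the opposite
regrading (`quadDualIso`). The linear dual in the bar construction reverses the sign once more, and
the dual bar constructions again agree up to `G`, compatibly with differentials
(`Operad.ShiftIso.dualBarDiff`) and with the natural maps (`naturalMap_shift`). The homology
condition is thereby carried from one degree to the other (`IsKoszul.shift`). The regrading
`Regrading.weight` with `c = d' - d` applies to all four families. -/

/-! ### Even regradings depending on the arity -/

/-- A rule for shifting the degrees of operads by even numbers that depend on the arity: operations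
occur only in the arities in `supp`, which are closed under partial compositions, and the shift is
additive under partial compositions. -/
structure Regrading where
  /-- The arities in which operations occur. -/
  supp : ℕ → Prop
  /-- The shift of the degree in a given arity. -/
  shift : ℕ → ℤ
  supp_one : supp 1
  shift_one : shift 1 = 0
  supp_circ : ∀ {m n l : ℕ}, m + n = l + 1 → supp m → supp n → supp l
  shift_circ : ∀ {m n l : ℕ}, m + n = l + 1 → supp m → supp n → shift l = shift m + shift n
  even_shift : ∀ a, Even (shift a)

/-- The opposite regrading. -/
def Regrading.neg (G : Regrading) : Regrading where
  supp := G.supp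
  shift a := -G.shift a
  supp_one := G.supp_one
  shift_one := by rw [G.shift_one, neg_zero]
  supp_circ := G.supp_circ
  shift_circ h hm hn := by rw [G.shift_circ h hm hn]; ring
  even_shift a := (G.even_shift a).neg

lemma Regrading.neg_eq (G : Regrading) {a : ℕ} {j j' : ℤ} (hj : j' = j + G.shift a) :
    j = j' + G.neg.shift a := by
  rw [hj]
  exact (add_neg_cancel_right j _).symm

lemma Regrading.eq_of_neg_eq (G : Regrading) {a : ℕ} {j j' : ℤ} (hj : j' = j + G.neg.shift a) :
    j = j' + G.shift a := by
  rw [hj]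
  exact (neg_add_cancel_right j _).symm

/-- The component of `↓ Q^#` in degree `j` is dual to that of `Q` in degree `-(j + 1)`. Shifting the
former therefore shifts the latter the opposite way. -/
lemma Regrading.neg_succ_eq (G : Regrading) {a : ℕ} {j j' : ℤ} (hj : j' = j + G.shift a) :
    -(j' + 1) = -(j + 1) + G.neg.shift a := by
  rw [hj]
  simp only [Regrading.neg]
  ring

section

variable {𝕜 : Type u} [Field 𝕜]

/-- The exponents differ by `xt + sy + st`, which is even. This is the invariance of Koszul signs
under even regradings. -/
lemma neg_one_zpow_even_shift {x y s t : ℤ} (hs : Even s) (ht : Even t) :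
    (-1 : 𝕜) ^ ((x + s) * (y + t)) = (-1 : 𝕜) ^ (x * y) := by
  obtain ⟨s, rfl⟩ := hs
  obtain ⟨t, rfl⟩ := ht
  exact neg_one_zpow_congr (s * y + x * t + 2 * s * t) (by ring)

/-! ### Isomorphisms up to a regrading, and regraded operads -/

/-- An isomorphism of the `Σ`-module `M`, regraded by `G`, with `N`. -/
structure SigmaModule.ShiftIso (G : Regrading) (M N : SigmaModule 𝕜) where
  eq_zero_left : ∀ {a : ℕ} {j : ℤ}, ¬ G.supp a → ∀ x : M.carrier a j, x = 0
  eq_zero_right : ∀ {a : ℕ} {j : ℤ}, ¬ G.supp a → ∀ x : N.carrier a j, x = 0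
  /-- The components of the isomorphism. -/
  equiv : ∀ {a : ℕ} {j j' : ℤ}, G.supp a → j' = j + G.shift a →
    (M.carrier a j ≃ₗ[𝕜] N.carrier a j')
  map_act : ∀ {a : ℕ} {j j' : ℤ} (ha : G.supp a) (hj : j' = j + G.shift a) (σ : Perm (Fin a))
    (x : M.carrier a j), equiv ha hj (M.act a j σ x) = N.act a j' σ (equiv ha hj x)

/-- An isomorphism of the operad `P`, regraded by `G`, with `Q`. -/
structure Operad.ShiftIso (G : Regrading) (P Q : Operad 𝕜) extends
    SigmaModule.ShiftIso G P.toSigmaModule Q.toSigmaModule where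
  map_one : ∀ {j j' : ℤ} (h1 : G.supp 1) (hj : j' = j + G.shift 1) (h : j = 0) (h' : j' = 0),
    equiv h1 hj (P.one j h) = Q.one j' h'
  map_circ : ∀ {m n l : ℕ} {p q r p' q' r' : ℤ} (hm : G.supp m) (hn : G.supp n) (hl : G.supp l)
    (hp : p' = p + G.shift m) (hq : q' = q + G.shift n) (hr : r' = r + G.shift l)
    (i : Fin m) (h : m + n = l + 1) (hd : p + q = r) (hd' : p' + q' = r')
    (x : P.carrier m p) (y : P.carrier n q),
    equiv hl hr (P.circ i h hd x y) = Q.circ i h hd' (equiv hm hp x) (equiv hn hq y)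

/-- The inverse of an isomorphism of `Σ`-modules up to a regrading. -/
def SigmaModule.ShiftIso.symm {G : Regrading} {M N : SigmaModule 𝕜}
    (e : SigmaModule.ShiftIso G M N) : SigmaModule.ShiftIso G.neg N M where
  eq_zero_left := e.eq_zero_right
  eq_zero_right := e.eq_zero_left
  equiv {_ j j'} ha hj := (e.equiv (j := j') (j' := j) ha (G.eq_of_neg_eq hj)).symm
  map_act {a _ _} ha _ σ _ := (LinearEquiv.symm_apply_eq _).2
    ((e.map_act (show G.supp a from ha) _ σ _).trans
      (congrArg _ (LinearEquiv.apply_symm_apply _ _))).symm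

open Classical in
/-- The operad `Q` with degrees shifted by `G`. -/
def Operad.regrade (Q : Operad 𝕜) (G : Regrading)
    (hQ : ∀ {a : ℕ} {j : ℤ}, ¬ G.supp a → ∀ x : Q.carrier a j, x = 0) : Operad 𝕜 where
  carrier a j := Q.carrier a (j + G.shift a)
  act a j := Q.act a (j + G.shift a)
  one j hj := Q.one _ (by rw [hj, G.shift_one, add_zero])
  circ {m n l p q r} i h hd :=
    -- Additivity of the shift is only known on the support, so elsewhere the degrees need not
    -- match. There one of the two factors vanishes and zero is the only possible composition.
    if hs : G.supp m ∧ G.supp n then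
      Q.circ i h (by rw [G.shift_circ h hs.1 hs.2]; linarith)
    else 0
  one_circ {n p q} i h hd hp x := by
    by_cases hn : G.supp n
    · subst hp
      rw [dif_pos ⟨G.supp_one, hn⟩]
      exact Q.one_circ i h _ _ x
    · exact (hQ hn _).trans (hQ hn _).symm
  circ_one {m p q} i hd hq x := by
    by_cases hm : G.supp m
    · rw [dif_pos ⟨hm, G.supp_one⟩]
      exact Q.circ_one i _ _ x
    · exact (hQ hm _).trans (hQ hm _).symm
  circ_act {m n l p q r} i h hd σ τ x y := by
    split_ifs with hs
    · exact Q.circ_act i h _ σ τ x y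
    · simp
  circ_seq {m n l mn nl mnl p q r pq qr pqr} i j i' h₁ h₂ h₃ h₄ d₁ d₂ d₃ d₄ hi x y z := by
    by_cases hm : G.supp m
    · by_cases hn : G.supp n
      · by_cases hl : G.supp l
        · rw [dif_pos ⟨G.supp_circ h₁ hm hn, hl⟩, dif_pos ⟨hm, hn⟩,
            dif_pos ⟨hm, G.supp_circ h₃ hn hl⟩, dif_pos ⟨hn, hl⟩]
          exact Q.circ_seq i j i' h₁ h₂ h₃ h₄ _ _ _ _ hi x y z
        · rw [hQ hl z]
          simp only [map_zero]
      · rw [hQ hn y]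
        simp only [map_zero, LinearMap.zero_apply]
    · rw [hQ hm x]
      simp only [map_zero, LinearMap.zero_apply]
  circ_par {m n l mn ml mnl p q r pq pr pqr} i j j' i' h₁ h₂ h₃ h₄ d₁ d₂ d₃ d₄ hij hj hi x y z := by
    by_cases hm : G.supp m
    · by_cases hn : G.supp n
      · by_cases hl : G.supp l
        · rw [dif_pos ⟨G.supp_circ h₁ hm hn, hl⟩, dif_pos ⟨hm, hn⟩,
            dif_pos ⟨G.supp_circ h₃ hm hl, hn⟩, dif_pos ⟨hm, hl⟩]
          refine (Q.circ_par (pr := pr + G.shift ml) i j j' i' h₁ h₂ h₃ h₄ _ _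
            (by rw [← d₃, G.shift_circ h₃ hm hl]; ring)
            (by rw [← d₄, G.shift_circ h₄ (G.supp_circ h₃ hm hl) hn]; ring)
            hij hj hi x y z).trans ?_
          -- Parallel associativity is the only axiom with a sign depending on degrees, hence the
          -- only one that needs the shifts to be even.
          rw [neg_one_zpow_even_shift (G.even_shift _) (G.even_shift _)]
        · rw [hQ hl z]
          simp only [map_zero, LinearMap.zero_apply, smul_zero]
      · rw [hQ hn y]
        simp only [map_zero, LinearMap.zero_apply, smul_zero]
    · rw [hQ hm x]
      simp only [map_zero, LinearMap.zero_apply, smul_zero]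

lemma Operad.regrade_circ (Q : Operad 𝕜) (G : Regrading)
    (hQ : ∀ {a : ℕ} {j : ℤ}, ¬ G.supp a → ∀ x : Q.carrier a j, x = 0)
    {m n l : ℕ} {p q r : ℤ} (i : Fin m) (h : m + n = l + 1) (hd : p + q = r)
    (hm : G.supp m) (hn : G.supp n) (x : Q.carrier m (p + G.shift m))
    (y : Q.carrier n (q + G.shift n)) :
    (Q.regrade G hQ).circ i h hd x y =
      Q.circ i h (by rw [G.shift_circ h hm hn]; linarith) x y := by
  simp only [Operad.regrade, dif_pos (And.intro hm hn)]
  rfl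

/-! ### Free operads on isomorphic generators -/

/-- Induction over the elements of the free operad. -/
lemma free_induction {M : SigmaModule 𝕜}
    {C : ∀ (a : ℕ) (j : ℤ), (free M).carrier a j → Prop}
    (gen : ∀ a j x, C a j (freeGen M a j x))
    (one : ∀ j hj, C 1 j ((free M).one j hj))
    (circ : ∀ {m n l : ℕ} {p q r : ℤ} (i : Fin m) (h : m + n = l + 1) (hd : p + q = r)
      (x : (free M).carrier m p) (y : (free M).carrier n q), C m p x → C n q y →
      C l r ((free M).circ i h hd x y))
    (act : ∀ a j σ x, C a j x → C a j ((free M).act a j σ x))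
    (zero : ∀ a j, C a j 0)
    (add : ∀ a j x y, C a j x → C a j y → C a j (x + y))
    (smul : ∀ a j (c : 𝕜) x, C a j x → C a j (c • x))
    {a : ℕ} {j : ℤ} (x : (free M).carrier a j) : C a j x := by
  suffices H : ∀ {a : ℕ} {j : ℤ} (t : FreePre M a j), C a j (freeMk t) by
    obtain ⟨t⟩ := x
    exact H t
  intro a j t
  induction t with
  | gen x => exact gen _ _ x
  | one j hj => exact one j hj
  | circ i h hd x y hx hy => exact circ i h hd _ _ hx hy
  | act σ x hx => exact act _ _ σ _ hx
  | zero a j => exact zero a j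
  | add x y hx hy => exact add _ _ _ _ hx hy
  | smul c x hx => exact smul _ _ c _ hx

/-- The free operad on a `Σ`-module that is supported in a set of arities closed under partial
compositions is supported there. -/
lemma free_eq_zero {G : Regrading} {M : SigmaModule 𝕜}
    (hM : ∀ {a : ℕ} {j : ℤ}, ¬ G.supp a → ∀ x : M.carrier a j, x = 0)
    {a : ℕ} {j : ℤ} (ha : ¬ G.supp a) (x : (free M).carrier a j) : x = 0 := by
  revert ha
  refine free_induction (C := fun a j x => ¬ G.supp a → x = 0) ?_ ?_ ?_ ?_ ?_ ?_ ?_ x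
  · intro a j x ha
    rw [hM ha x, map_zero]
  · intro j hj h
    exact absurd G.supp_one h
  · intro m n l p q r i h hd x y hx hy hl
    by_cases hm : G.supp m
    · by_cases hn : G.supp n
      · exact absurd (G.supp_circ h hm hn) hl
      · rw [hy hn, map_zero]
    · rw [hx hm, map_zero, LinearMap.zero_apply]
  · intro a j σ x hx ha
    rw [hx ha, map_zero]
  · intro a j _
    rfl
  · intro a j x y hx hy ha
    rw [hx ha, hy ha, add_zero]
  · intro a j c x hx ha
    rw [hx ha, smul_zero]

section

variable {G : Regrading} {M N : SigmaModule 𝕜}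

open Classical in
/-- The map `M → Γ(N)` induced by an isomorphism `M → N` up to a regrading. -/
def SigmaModule.ShiftIso.toFree (e : SigmaModule.ShiftIso G M N) (a : ℕ) (j : ℤ) :
    M.carrier a j →ₗ[𝕜] (free N).carrier a (j + G.shift a) :=
  if ha : G.supp a then (freeGen N a (j + G.shift a)).comp (e.equiv ha rfl).toLinearMap else 0

lemma SigmaModule.ShiftIso.toFree_act (e : SigmaModule.ShiftIso G M N) (a : ℕ) (j : ℤ)
    (σ : Perm (Fin a)) (x : M.carrier a j) :
    e.toFree a j (M.act a j σ x) = (free N).act a (j + G.shift a) σ (e.toFree a j x) := by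
  unfold SigmaModule.ShiftIso.toFree
  split_ifs with ha
  · simp only [LinearMap.comp_apply, LinearEquiv.coe_coe, e.map_act]
    exact freeMk_eq (.gen_act σ _)
  · simp only [LinearMap.zero_apply, map_zero]

/-- The map of free operads induced by an isomorphism of generators up to a regrading. -/
def SigmaModule.ShiftIso.freeMap (e : SigmaModule.ShiftIso G M N) {a : ℕ} {j j' : ℤ}
    (hj : j' = j + G.shift a) : (free M).carrier a j →ₗ[𝕜] (free N).carrier a j' :=
  -- A map up to a regrading is an honest degree-preserving morphism into the regraded free operad,
  -- so the universal property supplies it. The cast allows an arbitrary `j'` with a proof of its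
  -- value and disappears after `subst hj`.
  hj ▸ freeLift ((free N).regrade G (free_eq_zero e.eq_zero_right)) e.toFree e.toFree_act a j

lemma SigmaModule.ShiftIso.freeMap_gen (e : SigmaModule.ShiftIso G M N) {a : ℕ} {j j' : ℤ}
    (ha : G.supp a) (hj : j' = j + G.shift a) (x : M.carrier a j) :
    e.freeMap hj (freeGen M a j x) = freeGen N a j' (e.equiv ha hj x) := by
  subst hj
  change e.toFree a j x = _
  rw [SigmaModule.ShiftIso.toFree, dif_pos ha]
  rfl

lemma SigmaModule.ShiftIso.freeMap_one (e : SigmaModule.ShiftIso G M N) {j j' : ℤ}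
    (hj : j' = j + G.shift 1) (h : j = 0) (h' : j' = 0) :
    e.freeMap hj ((free M).one j h) = (free N).one j' h' := by
  subst hj
  rfl

lemma SigmaModule.ShiftIso.freeMap_act (e : SigmaModule.ShiftIso G M N) {a : ℕ} {j j' : ℤ}
    (hj : j' = j + G.shift a) (σ : Perm (Fin a)) (x : (free M).carrier a j) :
    e.freeMap hj ((free M).act a j σ x) = (free N).act a j' σ (e.freeMap hj x) := by
  subst hj
  obtain ⟨x⟩ := x
  rfl

lemma SigmaModule.ShiftIso.freeMap_circ (e : SigmaModule.ShiftIso G M N) {m n l : ℕ}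
    {p q r p' q' r' : ℤ} (hm : G.supp m) (hn : G.supp n)
    (hp : p' = p + G.shift m) (hq : q' = q + G.shift n) (hr : r' = r + G.shift l)
    (i : Fin m) (h : m + n = l + 1) (hd : p + q = r) (hd' : p' + q' = r')
    (x : (free M).carrier m p) (y : (free M).carrier n q) :
    e.freeMap hr ((free M).circ i h hd x y) =
      (free N).circ i h hd' (e.freeMap hp x) (e.freeMap hq y) := by
  subst hp hq hr
  obtain ⟨x⟩ := x
  obtain ⟨y⟩ := y
  exact ((free N).regrade_circ G (free_eq_zero e.eq_zero_right) i h hd hm hn _ _)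

/-- Both composites are morphisms determined by generators, where `he` applies. The inverse
regrading is a separate `H` because `G.neg.neg` is not definitionally `G`: the instances with `H =
G.neg`, and with `G.neg` and `G` in the two roles, give the two halves of
`SigmaModule.ShiftIso.freeIso`. -/
lemma SigmaModule.ShiftIso.freeMap_leftInverse (e : SigmaModule.ShiftIso G M N)
    {H : Regrading} (hs : ∀ {a}, G.supp a → H.supp a) (hG : ∀ a, H.shift a = -G.shift a)
    (e' : SigmaModule.ShiftIso H N M)
    (he : ∀ {a : ℕ} {j j' : ℤ} (ha : G.supp a) (hj : j' = j + G.shift a)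
      (hj' : j = j' + H.shift a) (x : M.carrier a j),
      e'.equiv (hs ha) hj' (e.equiv ha hj x) = x)
    {a : ℕ} {j j' : ℤ} (hj : j' = j + G.shift a) (hj' : j = j' + H.shift a)
    (x : (free M).carrier a j) :
    e'.freeMap hj' (e.freeMap hj x) = x := by
  revert j'
  refine free_induction (C := fun a j x => ∀ {j' : ℤ} (hj : j' = j + G.shift a)
    (hj' : j = j' + H.shift a), e'.freeMap hj' (e.freeMap hj x) = x) ?_ ?_ ?_ ?_ ?_ ?_ ?_ x
  · intro a j x j' hj hj'
    by_cases ha : G.supp a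
    · rw [e.freeMap_gen ha, e'.freeMap_gen (hs ha), he]
    · rw [e.eq_zero_left ha x]
      simp only [map_zero]
  · intro j hj j' h h'
    rw [e.freeMap_one h hj (by rw [h, hj, G.shift_one, add_zero]), e'.freeMap_one]
  · intro m n l p q r i h hd x y hx hy r' hr hr'
    by_cases hm : G.supp m
    · by_cases hn : G.supp n
      · rw [e.freeMap_circ hm hn rfl rfl hr i h hd (by rw [hr, G.shift_circ h hm hn]; linarith),
          e'.freeMap_circ (p' := p) (q' := q) (hs hm) (hs hn)
            (by rw [hG]; ring) (by rw [hG]; ring) hr' i h _ hd,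
          hx, hy]
      · rw [free_eq_zero e.eq_zero_left hn y]
        simp only [map_zero]
    · rw [free_eq_zero e.eq_zero_left hm x]
      simp only [map_zero, LinearMap.zero_apply]
  · intro a j σ x hx j' hj hj'
    rw [e.freeMap_act, e'.freeMap_act, hx]
  · intro a j j' hj hj'
    simp only [map_zero]
  · intro a j x y hx hy j' hj hj'
    rw [map_add, map_add, hx, hy]
  · intro a j c x hx j' hj hj'
    rw [map_smul, map_smul, hx]

/-- An isomorphism of `Σ`-modules up to a regrading induces one of free operads. -/
def SigmaModule.ShiftIso.freeIso (e : SigmaModule.ShiftIso G M N) :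
    Operad.ShiftIso G (free M) (free N) where
  eq_zero_left := free_eq_zero e.eq_zero_left
  eq_zero_right := free_eq_zero e.eq_zero_right
  equiv _ hj :=
    { e.freeMap hj with
      invFun := e.symm.freeMap (G.neg_eq hj)
      left_inv := fun x => e.freeMap_leftInverse (H := G.neg) id (fun _ => rfl) e.symm
        (fun _ _ _ _ => LinearEquiv.symm_apply_apply _ _) hj (G.neg_eq hj) x
      right_inv := fun x => e.symm.freeMap_leftInverse (H := G) id (fun _ => (neg_neg _).symm) e
        (fun _ _ _ _ => LinearEquiv.apply_symm_apply _ _) (G.neg_eq hj) hj x }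
  map_act _ hj σ x := e.freeMap_act hj σ x
  map_one _ hj h h' := e.freeMap_one hj h h'
  map_circ hm hn _ hp hq hr i h hd hd' x y := e.freeMap_circ hm hn hp hq hr i h hd hd' x y

end

variable {G : Regrading}

/-! ### Derivations and morphisms on free operads -/

lemma neg_one_zpow_add_even {x s : ℤ} (hs : Even s) : (-1 : 𝕜) ^ (x + s) = (-1 : 𝕜) ^ x := by
  obtain ⟨s, rfl⟩ := hs
  exact neg_one_zpow_congr s (by ring)

/-- Derivations of free operads that correspond to each other on generators correspond to each
other. -/
lemma SigmaModule.ShiftIso.freeIso_freeDeriv {M N : SigmaModule 𝕜}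
    (e : SigmaModule.ShiftIso G M N)
    {δ : ∀ a j, M.carrier a j →ₗ[𝕜] (free M).carrier a (j - 1)}
    (hδ : ∀ a j σ x, δ a j (M.act a j σ x) = (free M).act a (j - 1) σ (δ a j x))
    {δ' : ∀ a j, N.carrier a j →ₗ[𝕜] (free N).carrier a (j - 1)}
    (hδ' : ∀ a j σ x, δ' a j (N.act a j σ x) = (free N).act a (j - 1) σ (δ' a j x))
    (h : ∀ {a : ℕ} {j j' : ℤ} (ha : G.supp a) (hj : j' = j + G.shift a)
      (hj1 : j' - 1 = j - 1 + G.shift a) (x : M.carrier a j),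
      e.freeIso.equiv ha hj1 (δ a j x) = δ' a j' (e.equiv ha hj x))
    {a : ℕ} {j j' : ℤ} (ha : G.supp a) (hj : j' = j + G.shift a)
    (hj1 : j' - 1 = j - 1 + G.shift a) (x : (free M).carrier a j) :
    e.freeIso.equiv ha hj1 (freeDeriv δ hδ a j x) =
      freeDeriv δ' hδ' a j' (e.freeIso.equiv ha hj x) := by
  revert j'
  revert ha
  refine free_induction (C := fun a j x => ∀ (ha : G.supp a) {j' : ℤ} (hj : j' = j + G.shift a)
    (hj1 : j' - 1 = j - 1 + G.shift a),
    e.freeIso.equiv ha hj1 (freeDeriv δ hδ a j x) =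
      freeDeriv δ' hδ' a j' (e.freeIso.equiv ha hj x)) ?_ ?_ ?_ ?_ ?_ ?_ ?_ x
  · intro a j x ha j' hj hj1
    refine (h ha hj hj1 x).trans ?_
    exact (congrArg (freeDeriv δ' hδ' a j') (e.freeMap_gen ha hj x)).symm
  · intro j h0 ha j' hj hj1
    rw [e.freeIso.map_one ha hj h0 (by rw [hj, h0, G.shift_one, add_zero])]
    exact map_zero _
  · intro m n l p q r i hl hd x y hx hy hal r' hr hr1
    by_cases hm : G.supp m
    · by_cases hn : G.supp n
      · have hd' : p + G.shift m + (q + G.shift n) = r' := by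
          rw [hr, G.shift_circ hl hm hn]; linarith
        -- The Leibniz rule holds by definition on representatives; it is needed in both free
        -- operads.
        have h1 : freeDeriv δ hδ l r ((free M).circ i hl hd x y) =
            (free M).circ i hl (by omega) (freeDeriv δ hδ m p x) y +
              (-1 : 𝕜) ^ p • (free M).circ i hl (by omega) x (freeDeriv δ hδ n q y) := by
          obtain ⟨x⟩ := x
          obtain ⟨y⟩ := y
          rfl
        have h2 : ∀ {p q r} (hd : p + q = r) (x : (free N).carrier m p) (y : (free N).carrier n q),
            freeDeriv δ' hδ' l r ((free N).circ i hl hd x y) =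
            (free N).circ i hl (by omega) (freeDeriv δ' hδ' m p x) y +
              (-1 : 𝕜) ^ p • (free N).circ i hl (by omega) x (freeDeriv δ' hδ' n q y) := by
          rintro p q r hd ⟨x⟩ ⟨y⟩
          rfl
        -- The Leibniz sign on the right is that of degree `p + G.shift m`, and agrees with `(-1) ^
        -- p` because the shift is even.
        rw [h1, e.freeIso.map_circ hm hn hal rfl rfl hr i hl hd hd', h2, map_add, map_smul,
          e.freeIso.map_circ (p' := p + G.shift m - 1) (q' := q + G.shift n) hm hn hal (by ring) rfl
            hr1 i hl _ (by omega),
          e.freeIso.map_circ (p' := p + G.shift m) (q' := q + G.shift n - 1) hm hn hal rfl (by ring)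
            hr1 i hl _ (by omega),
          hx hm rfl, hy hn rfl, neg_one_zpow_add_even (G.even_shift m)]
      · rw [free_eq_zero e.eq_zero_left hn y]
        simp only [map_zero]
    · rw [free_eq_zero e.eq_zero_left hm x]
      simp only [map_zero, LinearMap.zero_apply]
  · intro a j σ x hx ha j' hj hj1
    have h1 : freeDeriv δ hδ a j ((free M).act a j σ x) =
        (free M).act a (j - 1) σ (freeDeriv δ hδ a j x) := by
      obtain ⟨x⟩ := x
      rfl
    have h2 : ∀ x, freeDeriv δ' hδ' a j' ((free N).act a j' σ x) =
        (free N).act a (j' - 1) σ (freeDeriv δ' hδ' a j' x) := by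
      rintro ⟨x⟩
      rfl
    rw [h1, e.freeIso.map_act, e.freeIso.map_act, h2, hx]
  · intro a j ha j' hj hj1
    simp only [map_zero]
  · intro a j x y hx hy ha j' hj hj1
    simp only [map_add, hx ha hj hj1, hy ha hj hj1]
  · intro a j c x hx ha j' hj hj1
    simp only [map_smul, hx ha hj hj1]

/-- Morphisms out of free operads that correspond to each other on generators correspond to each
other. -/
lemma SigmaModule.ShiftIso.freeIso_freeLift {M N : SigmaModule 𝕜} (e : SigmaModule.ShiftIso G M N)
    {P Q : Operad 𝕜} (E : Operad.ShiftIso G P Q)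
    {f : ∀ a j, M.carrier a j →ₗ[𝕜] P.carrier a j}
    (hf : ∀ a j σ x, f a j (M.act a j σ x) = P.act a j σ (f a j x))
    {f' : ∀ a j, N.carrier a j →ₗ[𝕜] Q.carrier a j}
    (hf' : ∀ a j σ x, f' a j (N.act a j σ x) = Q.act a j σ (f' a j x))
    (h : ∀ {a : ℕ} {j j' : ℤ} (ha : G.supp a) (hj : j' = j + G.shift a) (x : M.carrier a j),
      E.equiv ha hj (f a j x) = f' a j' (e.equiv ha hj x))
    {a : ℕ} {j j' : ℤ} (ha : G.supp a) (hj : j' = j + G.shift a) (x : (free M).carrier a j) :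
    E.equiv ha hj (freeLift P f hf a j x) = freeLift Q f' hf' a j' (e.freeIso.equiv ha hj x) := by
  revert j'
  revert ha
  refine free_induction (C := fun a j x => ∀ (ha : G.supp a) {j' : ℤ} (hj : j' = j + G.shift a),
    E.equiv ha hj (freeLift P f hf a j x) =
      freeLift Q f' hf' a j' (e.freeIso.equiv ha hj x)) ?_ ?_ ?_ ?_ ?_ ?_ ?_ x
  · intro a j x ha j' hj
    refine (h ha hj x).trans ?_
    exact (congrArg (freeLift Q f' hf' a j') (e.freeMap_gen ha hj x)).symm
  · intro j h0 ha j' hj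
    have h0' : j' = 0 := by rw [hj, h0, G.shift_one, add_zero]
    rw [e.freeIso.map_one ha hj h0 h0']
    exact E.map_one ha hj h0 h0'
  · intro m n l p q r i hl hd x y hx hy hal r' hr
    by_cases hm : G.supp m
    · by_cases hn : G.supp n
      · have hd' : p + G.shift m + (q + G.shift n) = r' := by
          rw [hr, G.shift_circ hl hm hn]; linarith
        have h1 : freeLift P f hf l r ((free M).circ i hl hd x y) =
            P.circ i hl hd (freeLift P f hf m p x) (freeLift P f hf n q y) := by
          obtain ⟨x⟩ := x
          obtain ⟨y⟩ := y
          rfl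
        have h2 : ∀ {p q r} (hd : p + q = r) (x : (free N).carrier m p) (y : (free N).carrier n q),
            freeLift Q f' hf' l r ((free N).circ i hl hd x y) =
            Q.circ i hl hd (freeLift Q f' hf' m p x) (freeLift Q f' hf' n q y) := by
          rintro p q r hd ⟨x⟩ ⟨y⟩
          rfl
        rw [h1, e.freeIso.map_circ hm hn hal rfl rfl hr i hl hd hd', h2,
          E.map_circ hm hn hal rfl rfl hr i hl hd hd', hx hm rfl, hy hn rfl]
      · rw [free_eq_zero e.eq_zero_left hn y]
        simp only [map_zero]
    · rw [free_eq_zero e.eq_zero_left hm x]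
      simp only [map_zero, LinearMap.zero_apply]
  · intro a j σ x hx ha j' hj
    have h1 : freeLift P f hf a j ((free M).act a j σ x) =
        P.act a j σ (freeLift P f hf a j x) := by
      obtain ⟨x⟩ := x
      rfl
    have h2 : ∀ x, freeLift Q f' hf' a j' ((free N).act a j' σ x) =
        Q.act a j' σ (freeLift Q f' hf' a j' x) := by
      rintro ⟨x⟩
      rfl
    rw [h1, e.freeIso.map_act, E.map_act, h2, hx]
  · intro a j ha j' hj
    simp only [map_zero]
  · intro a j x y hx hy ha j' hj
    simp only [map_add, hx ha hj, hy ha hj]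
  · intro a j c x hx ha j' hj
    simp only [map_smul, hx ha hj]

/-! ### Inverses, quotients, suspensions, duals and restrictions -/

/-- The inverse of an isomorphism of operads up to a regrading. -/
def Operad.ShiftIso.symm {P Q : Operad 𝕜} (e : Operad.ShiftIso G P Q) :
    Operad.ShiftIso G.neg Q P where
  toShiftIso := e.toShiftIso.symm
  map_one h1 _ h h' := (LinearEquiv.symm_apply_eq _).2
    (e.map_one (show G.supp 1 from h1) _ h' h).symm
  map_circ {_ _ _ p q r p' q' r'} hm hn hl hp hq hr i h hd hd' x y :=
    (LinearEquiv.symm_apply_eq _).2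
      ((e.map_circ (p := p') (p' := p) (q := q') (q' := q) (r := r') (r' := r) hm hn hl
          (G.eq_of_neg_eq hp) (G.eq_of_neg_eq hq)
          (G.eq_of_neg_eq hr) i h hd' hd _ _).trans
        (congrArg₂ (fun x y => Q.circ i h hd x y) (LinearEquiv.apply_symm_apply _ x)
          (LinearEquiv.apply_symm_apply _ y))).symm

/-- The ideal is built from operations that `e` respects, so induction on its construction suffices.
A composite in a supported arity may have factors in unsupported arities; these are zero, and so is
the composite. -/
lemma Operad.ShiftIso.idealMem {P Q : Operad 𝕜} (e : Operad.ShiftIso G P Q)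
    {R : ∀ a j, Set (P.carrier a j)} {S : ∀ a j, Set (Q.carrier a j)}
    (hR : ∀ {a : ℕ} {j j' : ℤ} (ha : G.supp a) (hj : j' = j + G.shift a) (x : P.carrier a j),
      x ∈ R a j → e.equiv ha hj x ∈ S a j')
    {a : ℕ} {j j' : ℤ} (ha : G.supp a) (hj : j' = j + G.shift a) {x : P.carrier a j}
    (hx : P.IdealMem R a j x) : Q.IdealMem S a j' (e.equiv ha hj x) := by
  induction hx generalizing j' with
  | of x hx => exact .of _ (hR ha hj x hx)
  | zero a j => rw [map_zero]; exact .zero _ _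
  | add x y _ _ hx hy => rw [map_add]; exact .add _ _ (hx ha hj) (hy ha hj)
  | smul c x _ hx => rw [map_smul]; exact .smul _ _ (hx ha hj)
  | act σ x _ hx => rw [e.map_act]; exact .act _ _ (hx ha hj)
  | @circ_left m n l p q r i h hd x y _ hx =>
    by_cases hm : G.supp m
    · by_cases hn : G.supp n
      · rw [e.map_circ hm hn ha rfl rfl hj i h hd
          (by rw [hj, G.shift_circ h hm hn]; linarith)]
        exact .circ_left _ _ _ _ _ (hx hm rfl)
      · rw [e.eq_zero_left hn y, map_zero, map_zero]
        exact .zero _ _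
    · rw [e.eq_zero_left hm x, map_zero, LinearMap.zero_apply, map_zero]
      exact .zero _ _
  | @circ_right m n l p q r i h hd x y _ hy =>
    by_cases hm : G.supp m
    · by_cases hn : G.supp n
      · rw [e.map_circ hm hn ha rfl rfl hj i h hd
          (by rw [hj, G.shift_circ h hm hn]; linarith)]
        exact .circ_right _ _ _ _ _ (hy hn rfl)
      · rw [e.eq_zero_left hn y, map_zero, map_zero]
        exact .zero _ _
    · rw [e.eq_zero_left hm x, map_zero, LinearMap.zero_apply, map_zero]
      exact .zero _ _

/-- Isomorphisms of operads up to a regrading that match the relations descend to quotients. -/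
def Operad.ShiftIso.quotient {P Q : Operad 𝕜} (e : Operad.ShiftIso G P Q)
    {R : ∀ a j, Set (P.carrier a j)} {S : ∀ a j, Set (Q.carrier a j)}
    (hR : ∀ {a : ℕ} {j j' : ℤ} (ha : G.supp a) (hj : j' = j + G.shift a) (x : P.carrier a j),
      x ∈ R a j → e.equiv ha hj x ∈ S a j')
    (hS : ∀ {a : ℕ} {j j' : ℤ} (ha : G.supp a) (hj : j' = j + G.neg.shift a)
      (x : Q.carrier a j), x ∈ S a j → e.symm.equiv ha hj x ∈ R a j') :
    Operad.ShiftIso G (P.quotient R) (Q.quotient S) where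
  eq_zero_left ha x := by
    obtain ⟨x, rfl⟩ := Submodule.Quotient.mk_surjective _ x
    rw [e.eq_zero_left ha x]
    rfl
  eq_zero_right ha x := by
    obtain ⟨x, rfl⟩ := Submodule.Quotient.mk_surjective _ x
    rw [e.eq_zero_right ha x]
    rfl
  equiv {a j j'} ha hj := Submodule.Quotient.equiv (P.ideal R a j) (Q.ideal S a j')
    (e.equiv ha hj) (by
      ext y
      rw [Submodule.mem_map]
      constructor
      · rintro ⟨x, hx, rfl⟩
        exact e.idealMem hR ha hj hx
      · intro hy
        refine ⟨(e.equiv ha hj).symm y, ?_, LinearEquiv.apply_symm_apply _ y⟩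
        -- Equality of the ideals, not just an inclusion, comes from applying the same lemma to the
        -- inverse.
        exact e.symm.idealMem hS (j' := j) (show G.neg.supp a from ha)
          (G.neg_eq hj) hy)
  map_act ha hj σ x := by
    obtain ⟨x, rfl⟩ := Submodule.Quotient.mk_surjective _ x
    exact congrArg (Submodule.mkQ _) (e.map_act ha hj σ x)
  map_one h1 hj h h' := congrArg (Submodule.mkQ _) (e.map_one h1 hj h h')
  map_circ hm hn hl hp hq hr i h hd hd' x y := by
    obtain ⟨x, rfl⟩ := Submodule.Quotient.mk_surjective _ x
    obtain ⟨y, rfl⟩ := Submodule.Quotient.mk_surjective _ y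
    exact congrArg (Submodule.mkQ _) (e.map_circ hm hn hl hp hq hr i h hd hd' x y)

/-- The operadic suspension of an isomorphism up to a regrading. -/
def Operad.ShiftIso.suspend {P Q : Operad 𝕜} (e : Operad.ShiftIso G P Q) (ε : ℤˣ) :
    Operad.ShiftIso G (P.suspend ε) (Q.suspend ε) where
  eq_zero_left ha x := e.eq_zero_left ha x
  eq_zero_right ha x := e.eq_zero_right ha x
  equiv {a j j'} ha hj := e.equiv (j := j - ε * ((a : ℤ) - 1)) (j' := j' - ε * ((a : ℤ) - 1)) ha
    (by rw [hj]; ring)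
  map_act ha hj σ x := by
    refine (map_smul (e.equiv ha _) _ _).trans ?_
    exact congrArg _ (e.map_act ha _ σ x)
  map_one h1 hj h h' := e.map_one h1 _ _ _
  map_circ {m n l p q r p' q' r'} hm hn hl hp hq hr i h hd hd' x y := by
    refine (map_smul (e.equiv hl _) _ _).trans ?_
    refine Eq.trans ?_ (congrArg (fun c : 𝕜 => c • Q.circ i h _ _ _) (?_ :
      (-1 : 𝕜) ^ ((p - ε * ((m : ℤ) - 1)) * ((n : ℤ) - 1) + (i : ℤ) * ((n : ℤ) - 1)) = _))
    · exact congrArg _ (e.map_circ hm hn hl _ _ _ i h _ (suspend_degree (ε : ℤ) h hd') x y)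
    -- The suspension sign sees only the degree of the first factor. Regrading changes its exponent
    -- by `G.shift m * (n - 1)`, an even number.
    · obtain ⟨s, hs⟩ := G.even_shift m
      rw [hp, hs]
      exact neg_one_zpow_congr (-s * ((n : ℤ) - 1)) (by ring)

/-- The desuspended dual of an isomorphism up to a regrading. -/
def Operad.ShiftIso.desuspendDual {P Q : Operad 𝕜} (e : Operad.ShiftIso G.neg P Q) :
    SigmaModule.ShiftIso G P.desuspendDual Q.desuspendDual where
  eq_zero_left {a j} ha φ := LinearMap.ext fun x => by
    let ψ : Module.Dual 𝕜 (P.carrier a (-(j + 1))) := φ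
    exact (congrArg (fun y => ψ y) (e.eq_zero_left ha x)).trans (map_zero ψ)
  eq_zero_right {a j} ha φ := LinearMap.ext fun x => by
    let ψ : Module.Dual 𝕜 (Q.carrier a (-(j + 1))) := φ
    exact (congrArg (fun y => ψ y) (e.eq_zero_right ha x)).trans (map_zero ψ)
  -- Functionals are transported by precomposition with the inverse; the hypothesis regrades by
  -- `G.neg` so that the dual regrades by `G`.
  equiv {a j j'} ha hj := (e.equiv ha (G.neg_succ_eq hj)).symm.dualMap
  map_act {a j j'} ha hj σ φ := LinearMap.ext fun x => by
    let ψ : Module.Dual 𝕜 (P.carrier a (-(j + 1))) := φ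
    exact congrArg (fun y => ψ y) ((LinearEquiv.symm_apply_eq _).2
      ((e.map_act ha (G.neg_succ_eq hj) σ⁻¹ _).trans
        (congrArg _ (LinearEquiv.apply_symm_apply _ x))).symm).symm

/-- The restriction of an isomorphism up to a regrading to parts that correspond to each other. -/
def SigmaModule.ShiftIso.restrict {M N : SigmaModule 𝕜} (e : SigmaModule.ShiftIso G M N)
    {c c' : ℕ → ℤ → Prop} (hc : ∀ {a j j'}, G.supp a → j' = j + G.shift a → (c a j ↔ c' a j')) :
    SigmaModule.ShiftIso G (M.restrict c) (N.restrict c') where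
  eq_zero_left ha x := Subtype.ext (e.eq_zero_left ha x.1)
  eq_zero_right ha x := Subtype.ext (e.eq_zero_right ha x.1)
  equiv {a j j'} ha hj := (e.equiv ha hj).submoduleMap _ ≪≫ₗ LinearEquiv.ofEq _ _ (by
    ext y
    rw [Submodule.mem_map]
    constructor
    · rintro ⟨x, hx | rfl, rfl⟩
      · exact Or.inl ((hc ha hj).1 hx)
      · exact Or.inr (map_zero _)
    · rintro (hy | rfl)
      · exact ⟨_, Or.inl ((hc ha hj).2 hy), LinearEquiv.apply_symm_apply _ y⟩
      · exact ⟨0, Or.inr rfl, map_zero _⟩)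
  map_act ha hj σ x := Subtype.ext (e.map_act ha hj σ x.1)

/-! ### Quadratic operads with generators in different degrees -/

/-- The isomorphism between the regular representations in arity `n` and different degrees. -/
def oneGenIso (𝕜 : Type u) [Field 𝕜] {n : ℕ} {d d' : ℤ} (hn : G.supp n)
    (hd : d' = d + G.shift n) : SigmaModule.ShiftIso G (oneGen 𝕜 n d) (oneGen 𝕜 n d') where
  eq_zero_left ha x := by
    rcases x.2 with h | h
    · exact absurd (h.1 ▸ hn) ha
    · exact Subtype.ext h
  eq_zero_right ha x := by
    rcases x.2 with h | h
    · exact absurd (h.1 ▸ hn) ha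
    · exact Subtype.ext h
  equiv {a j j'} ha hj :=
    { toFun := fun x => ⟨x.1, x.2.imp_left fun h => ⟨h.1, by rw [hj, hd, h.2, h.1]⟩⟩
      invFun := fun x => ⟨x.1, x.2.imp_left fun h => ⟨h.1, by
        have h2 := h.2
        rw [hj, hd, h.1] at h2
        exact add_right_cancel h2⟩⟩
      map_add' := fun _ _ => rfl
      map_smul' := fun _ _ => rfl
      left_inv := fun _ => rfl
      right_inv := fun _ => rfl }
  map_act _ _ _ _ := rfl

/-- Coordinates refer to the elements `σ (μ ∘ᵢ μ)`. The isomorphism takes generator to generator and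
respects composition and action without signs, so a relation keeps its coordinates. -/
lemma oneGenIso_quadElem {n : ℕ} {d d' : ℤ} (hn : G.supp n) (hd : d' = d + G.shift n)
    (h : G.supp (2 * n - 1)) (hj : 2 * d' = 2 * d + G.shift (2 * n - 1)) (r : QuadCoord 𝕜 n) :
    (oneGenIso 𝕜 hn hd).freeIso.equiv h hj (quadElem n d r) = quadElem n d' r := by
  simp only [quadElem, map_sum, map_smul]
  refine Finset.sum_congr rfl fun i _ => Finset.sum_congr rfl fun σ _ => congrArg _ ?_
  rw [(oneGenIso 𝕜 hn hd).freeIso.map_act,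
    (oneGenIso 𝕜 hn hd).freeIso.map_circ hn hn h hd hd hj i _ _ (by ring)]
  have hg : (oneGenIso 𝕜 hn hd).freeIso.equiv hn hd
      (freeGen _ n d (oneGenElem 𝕜 n d n d ⟨rfl, rfl⟩)) =
      freeGen _ n d' (oneGenElem 𝕜 n d' n d' ⟨rfl, rfl⟩) :=
    (oneGenIso 𝕜 hn hd).freeMap_gen hn hd _
  rw [hg]

/-- The operads given by the same quadratic relations between the compositions of an operation of
arity `n` in different degrees are isomorphic up to a regrading. -/
def quadraticIso {n : ℕ} {d d' : ℤ} (hn : G.supp n) (hn1 : 1 ≤ n) (hd : d' = d + G.shift n)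
    (R : Set (QuadCoord 𝕜 n)) : Operad.ShiftIso G (quadratic n d R) (quadratic n d' R) :=
  -- Quadratic elements contain two generators and so shift by `2 * G.shift n`. The truncated
  -- subtraction in `2 * n - 1` is harmless because `1 ≤ n`.
  have hj : 2 * d' = 2 * d + G.shift (2 * n - 1) := by
    rw [hd, G.shift_circ (show n + n = 2 * n - 1 + 1 by omega) hn hn]; ring
  (oneGenIso 𝕜 hn hd).freeIso.quotient
    (by
      rintro a j j' ha hj' x ⟨r, hr⟩
      obtain rfl : 2 * d' = j' := by rw [hj', hj]
      rw [oneGenIso_quadElem]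
      exact ⟨r, hr⟩)
    (by
      rintro a j j' ha hj' x ⟨r, hr⟩
      obtain rfl : 2 * d = j' := by
        rw [hj', hj]; exact (add_neg_cancel_right _ _).symm
      have := (LinearEquiv.symm_apply_eq _).2 (oneGenIso_quadElem hn hd ha hj r).symm
      rw [show (oneGenIso 𝕜 hn hd).freeIso.symm.equiv ha hj' (quadElem n d' r) = quadElem n d r
        from this]
      exact ⟨r, hr⟩)

lemma quadraticIso_quadGen {n : ℕ} {d d' : ℤ} (hn : G.supp n) (hn1 : 1 ≤ n)
    (hd : d' = d + G.shift n) (R : Set (QuadCoord 𝕜 n)) {a : ℕ} {j j' : ℤ} (ha : G.supp a)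
    (hj : j' = j + G.shift a) (h : a = n ∧ j = d) (h' : a = n ∧ j' = d') :
    (quadraticIso hn hn1 hd R).equiv ha hj (quadGen n d R a j h) = quadGen n d' R a j' h' :=
  congrArg (Submodule.mkQ _) ((oneGenIso 𝕜 hn hd).freeMap_gen ha hj _)

/-! ### The dual bar construction -/

/-- In finite dimensions every functional comes from a tensor of functionals, and on pure tensors
naturality is definitional. Otherwise both sides take the default value zero, since isomorphisms
preserve finiteness; no dimension hypothesis is then needed later. -/
lemma dualSplit_congr {V V' W W' : Type u} [AddCommGroup V] [Module 𝕜 V] [AddCommGroup V']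
    [Module 𝕜 V'] [AddCommGroup W] [Module 𝕜 W] [AddCommGroup W'] [Module 𝕜 W']
    (e : V ≃ₗ[𝕜] V') (f : W ≃ₗ[𝕜] W') (φ : Module.Dual 𝕜 (TensorProduct 𝕜 V W)) :
    dualSplit V' W' (φ.comp (TensorProduct.map e.symm.toLinearMap f.symm.toLinearMap)) =
      TensorProduct.map e.symm.dualMap.toLinearMap f.symm.dualMap.toLinearMap
        (dualSplit V W φ) := by
  by_cases h : Module.Finite 𝕜 V ∧ Module.Finite 𝕜 W
  · have h' : Module.Finite 𝕜 V' ∧ Module.Finite 𝕜 W' :=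
      ⟨h.1.equiv e, h.2.equiv f⟩
    obtain ⟨_, _⟩ := h
    obtain ⟨_, _⟩ := h'
    simp only [dualSplit, dif_pos (And.intro ‹Module.Finite 𝕜 V› ‹Module.Finite 𝕜 W›),
      dif_pos (And.intro ‹Module.Finite 𝕜 V'› ‹Module.Finite 𝕜 W'›), LinearEquiv.coe_coe]
    rw [LinearEquiv.symm_apply_eq]
    obtain ⟨t, rfl⟩ := (TensorProduct.dualDistribEquiv 𝕜 V W).surjective φ
    rw [LinearEquiv.symm_apply_apply]
    induction t with
    | zero => simp only [map_zero, LinearMap.zero_comp]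
    | add x y hx hy => simp only [map_add, LinearMap.add_comp, hx, hy]
    | tmul x y =>
      ext v w
      rfl
  · have h' : ¬ (Module.Finite 𝕜 V' ∧ Module.Finite 𝕜 W') := fun h' =>
      h ⟨h'.1.equiv e.symm, h'.2.equiv f.symm⟩
    simp only [dualSplit, dif_neg h, dif_neg h', LinearMap.zero_apply, map_zero]

variable {P Q : Operad 𝕜}

/-- The isomorphism of the duals of the desuspensions. -/
def Operad.ShiftIso.dualSuspend (e : Operad.ShiftIso G.neg P Q) :
    SigmaModule.ShiftIso G (P.suspend (-1)).desuspendDual (Q.suspend (-1)).desuspendDual :=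
  (e.suspend (-1)).desuspendDual

/-- The isomorphism of the generators of the dual bar constructions. -/
def Operad.ShiftIso.dualBarGen (e : Operad.ShiftIso G.neg P Q) :
    SigmaModule.ShiftIso G P.dualBarGen Q.dualBarGen :=
  e.dualSuspend.restrict fun _ _ => Iff.rfl

lemma Operad.ShiftIso.dualBarGen_incl (e : Operad.ShiftIso G.neg P Q) {a : ℕ} {j j' : ℤ}
    (ha : G.supp a) (hj : j' = j + G.shift a) (x : P.dualBarGen.carrier a j) :
    e.dualSuspend.equiv ha hj (P.dualBarIncl a j x) =
      Q.dualBarIncl a j' (e.dualBarGen.equiv ha hj x) := rfl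

lemma Operad.dualBarProj_of_le (P : Operad 𝕜) {a : ℕ} {j : ℤ} (h : 2 ≤ a)
    (x : (P.suspend (-1)).desuspendDual.carrier a j) :
    P.dualBarProj a j x = ⟨x, Or.inl h⟩ :=
  congrArg (fun f : _ →ₗ[𝕜] P.dualBarGen.carrier a j => f x) (dif_pos h)

lemma Operad.dualBarProj_of_not_le (P : Operad 𝕜) {a : ℕ} {j : ℤ} (h : ¬ 2 ≤ a)
    (x : (P.suspend (-1)).desuspendDual.carrier a j) : P.dualBarProj a j x = 0 :=
  congrArg (fun f : _ →ₗ[𝕜] P.dualBarGen.carrier a j => f x) (dif_neg h)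

lemma Operad.ShiftIso.dualBarGen_proj (e : Operad.ShiftIso G.neg P Q) {a : ℕ} {j j' : ℤ}
    (ha : G.supp a) (hj : j' = j + G.shift a)
    (x : (P.suspend (-1)).desuspendDual.carrier a j) :
    e.dualBarGen.equiv ha hj (P.dualBarProj a j x) =
      Q.dualBarProj a j' (e.dualSuspend.equiv ha hj x) := by
  by_cases h : 2 ≤ a
  · rw [P.dualBarProj_of_le h, Q.dualBarProj_of_le h]
    rfl
  · rw [P.dualBarProj_of_not_le h, Q.dualBarProj_of_not_le h, map_zero]

/-- The decomposition of a functional on a component of `s⁻¹ P` along a partial composition. -/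
def Operad.dualBarSplit (P : Operad 𝕜) {m n a : ℕ} {j₁ j₂ j : ℤ} (i : Fin m) (h : m + n = a + 1)
    (hd : j₁ + j₂ = j - 1) : (P.suspend (-1)).desuspendDual.carrier a j →ₗ[𝕜]
      TensorProduct 𝕜 ((P.suspend (-1)).desuspendDual.carrier m j₁)
        ((P.suspend (-1)).desuspendDual.carrier n j₂) :=
  (dualSplit ((P.suspend (-1)).carrier m (-(j₁ + 1)))
    ((P.suspend (-1)).carrier n (-(j₂ + 1)))).comp
      (Module.Dual.transpose (TensorProduct.lift
        ((P.suspend (-1)).circ i h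
          (show -(j₁ + 1) + -(j₂ + 1) = -(j + 1) by omega))))

/-- The composition in the free operad of two functionals as generators of the dual bar
construction. -/
def Operad.dualBarGraft (P : Operad 𝕜) {m n a : ℕ} {j₁ j₂ j : ℤ} (i : Fin m) (h : m + n = a + 1)
    (hd : j₁ + j₂ = j - 1) : TensorProduct 𝕜 ((P.suspend (-1)).desuspendDual.carrier m j₁)
        ((P.suspend (-1)).desuspendDual.carrier n j₂) →ₗ[𝕜]
      (free P.dualBarGen).carrier a (j - 1) :=
  TensorProduct.lift (((free P.dualBarGen).circ i h hd).compl₁₂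
    ((freeGen P.dualBarGen m j₁).comp (P.dualBarProj m j₁))
    ((freeGen P.dualBarGen n j₂).comp (P.dualBarProj n j₂)))

/-- This separates a term of the differential into its sign, a decomposition dual to `∘ᵢ`, and a
grafting in the free operad, so that each can be compared on its own. -/
lemma Operad.dualBarTerm_apply (P : Operad 𝕜) {m n a : ℕ} {j₁ j₂ j : ℤ} (i : Fin m)
    (h : m + n = a + 1) (hd : j₁ + j₂ = j - 1)
    (φ : (P.suspend (-1)).desuspendDual.carrier a j) :
    P.dualBarTerm i h hd φ =
      (-1 : 𝕜) ^ ((j₁ + 1) * j₂) • P.dualBarGraft i h hd (P.dualBarSplit i h hd φ) := rfl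

/-- This is the transpose of the compatibility of `e.suspend (-1)` with `∘ᵢ`, combined with the
naturality of `dualSplit`. -/
lemma Operad.ShiftIso.dualBarSplit (e : Operad.ShiftIso G.neg P Q) {m n a : ℕ}
    {j₁ j₂ j j₁' j₂' j' : ℤ} (hm : G.supp m) (hn : G.supp n) (ha : G.supp a)
    (hj₁ : j₁' = j₁ + G.shift m) (hj₂ : j₂' = j₂ + G.shift n) (hj : j' = j + G.shift a)
    (i : Fin m) (h : m + n = a + 1) (hd : j₁ + j₂ = j - 1) (hd' : j₁' + j₂' = j' - 1)
    (φ : (P.suspend (-1)).desuspendDual.carrier a j) :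
    Q.dualBarSplit i h hd' (e.dualSuspend.equiv ha hj φ) =
      TensorProduct.map (e.dualSuspend.equiv hm hj₁).toLinearMap
        (e.dualSuspend.equiv hn hj₂).toLinearMap (P.dualBarSplit i h hd φ) := by
  refine Eq.trans ?_ (dualSplit_congr ((e.suspend (-1)).equiv hm (G.neg_succ_eq hj₁))
    ((e.suspend (-1)).equiv hn (G.neg_succ_eq hj₂)) _)
  refine congrArg (dualSplit _ _) ?_
  refine TensorProduct.ext' fun x y => ?_
  let ψ : Module.Dual 𝕜 ((P.suspend (-1)).carrier a (-(j + 1))) := φ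
  refine congrArg (fun z => ψ z) ((LinearEquiv.symm_apply_eq _).2 ?_)
  refine Eq.trans ?_ ((e.suspend (-1)).map_circ hm hn ha (G.neg_succ_eq hj₁)
    (G.neg_succ_eq hj₂) (G.neg_succ_eq hj) i h (by omega) (by omega) _ _).symm
  exact (congrArg₂ (fun x y => (Q.suspend (-1)).circ i h _ x y)
    (LinearEquiv.apply_symm_apply _ x) (LinearEquiv.apply_symm_apply _ y)).symm

lemma Operad.ShiftIso.dualBarGraft (e : Operad.ShiftIso G.neg P Q) {m n a : ℕ}
    {j₁ j₂ j j₁' j₂' j' : ℤ} (hm : G.supp m) (hn : G.supp n) (ha : G.supp a)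
    (hj₁ : j₁' = j₁ + G.shift m) (hj₂ : j₂' = j₂ + G.shift n)
    (hj1 : j' - 1 = j - 1 + G.shift a)
    (i : Fin m) (h : m + n = a + 1) (hd : j₁ + j₂ = j - 1) (hd' : j₁' + j₂' = j' - 1)
    (t : TensorProduct 𝕜 ((P.suspend (-1)).desuspendDual.carrier m j₁)
      ((P.suspend (-1)).desuspendDual.carrier n j₂)) :
    e.dualBarGen.freeIso.equiv ha hj1 (P.dualBarGraft i h hd t) =
      Q.dualBarGraft i h hd' (TensorProduct.map (e.dualSuspend.equiv hm hj₁).toLinearMap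
        (e.dualSuspend.equiv hn hj₂).toLinearMap t) := by
  induction t with
  | zero => simp only [map_zero]
  | add x y hx hy => simp only [map_add, hx, hy]
  | tmul x y =>
    refine (e.dualBarGen.freeIso.map_circ hm hn ha hj₁ hj₂ hj1 i h hd hd'
      (freeGen P.dualBarGen m j₁ (P.dualBarProj m j₁ x))
      (freeGen P.dualBarGen n j₂ (P.dualBarProj n j₂ y))).trans ?_
    have hg : ∀ {b : ℕ} {k k' : ℤ} (hb : G.supp b) (hk : k' = k + G.shift b)
        (z : (P.suspend (-1)).desuspendDual.carrier b k),
        e.dualBarGen.freeIso.equiv hb hk (freeGen P.dualBarGen b k (P.dualBarProj b k z)) =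
          freeGen Q.dualBarGen b k' (Q.dualBarProj b k' (e.dualSuspend.equiv hb hk z)) := by
      intro b k k' hb hk z
      exact (e.dualBarGen.freeMap_gen hb hk _).trans
        (congrArg _ (e.dualBarGen_proj hb hk z))
    exact congrArg₂ (fun x y => (free Q.dualBarGen).circ i h hd' x y) (hg hm hj₁ x) (hg hn hj₂ y)

/-- Decomposition and grafting are natural, and the sign `(-1) ^ ((j₁ + 1) * j₂)` survives because
`j₁` and `j₂` move by even amounts. -/
lemma Operad.ShiftIso.dualBarTerm (e : Operad.ShiftIso G.neg P Q) {m n a : ℕ}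
    {j₁ j₂ j j₁' j₂' j' : ℤ} (hm : G.supp m) (hn : G.supp n) (ha : G.supp a)
    (hj₁ : j₁' = j₁ + G.shift m) (hj₂ : j₂' = j₂ + G.shift n) (hj : j' = j + G.shift a)
    (hj1 : j' - 1 = j - 1 + G.shift a)
    (i : Fin m) (h : m + n = a + 1) (hd : j₁ + j₂ = j - 1) (hd' : j₁' + j₂' = j' - 1)
    (φ : (P.suspend (-1)).desuspendDual.carrier a j) :
    e.dualBarGen.freeIso.equiv ha hj1 (P.dualBarTerm i h hd φ) =
      Q.dualBarTerm i h hd' (e.dualSuspend.equiv ha hj φ) := by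
  rw [Operad.dualBarTerm_apply, Operad.dualBarTerm_apply, map_smul,
    e.dualBarGraft hm hn ha hj₁ hj₂ hj1 i h hd hd', e.dualBarSplit hm hn ha hj₁ hj₂ hj i h hd hd']
  congr 1
  rw [hj₁, hj₂, show j₁ + G.shift m + 1 = j₁ + 1 + G.shift m by ring,
    neg_one_zpow_even_shift (G.even_shift m) (G.even_shift n)]

/-- The differential sums over all pairs of arities with the right total, including unsupported
ones. There one of the grafted generators is zero. -/
lemma Operad.dualBarTerm_eq_zero (P : Operad 𝕜)
    (hP : ∀ {a : ℕ} {j : ℤ}, ¬ G.supp a → ∀ x : P.dualBarGen.carrier a j, x = 0)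
    {m n a : ℕ} {j₁ j₂ j : ℤ} (i : Fin m) (h : m + n = a + 1) (hd : j₁ + j₂ = j - 1)
    (hmn : ¬ (G.supp m ∧ G.supp n)) :
    P.dualBarTerm (j₁ := j₁) (j₂ := j₂) (j := j) i h hd = 0 := by
  ext φ
  rw [Operad.dualBarTerm_apply]
  suffices H : P.dualBarGraft (j₁ := j₁) (j₂ := j₂) (j := j) i h hd = 0 by
    rw [H]
    exact smul_zero _
  refine TensorProduct.ext' fun x y => ?_
  change (free P.dualBarGen).circ i h hd (freeGen P.dualBarGen m j₁ (P.dualBarProj m j₁ x))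
    (freeGen P.dualBarGen n j₂ (P.dualBarProj n j₂ y)) = 0
  by_cases hm : G.supp m
  · rw [hP (fun hn => hmn ⟨hm, hn⟩) (P.dualBarProj n j₂ y)]
    simp only [map_zero]
  · rw [hP hm (P.dualBarProj m j₁ x)]
    simp only [map_zero, LinearMap.zero_apply]

/-- Regrading moves the degree of the first factor by `G.shift m`, so the two sums correspond under
a translation of the index. -/
lemma Operad.ShiftIso.finsum_dualBarTerm (e : Operad.ShiftIso G.neg P Q) {m n a : ℕ}
    {j j' : ℤ} (ha : G.supp a) (hj : j' = j + G.shift a) (hj1 : j' - 1 = j - 1 + G.shift a)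
    (i : Fin m) (h : m + n = a + 1) (φ : (P.suspend (-1)).desuspendDual.carrier a j) :
    e.dualBarGen.freeIso.equiv ha hj1
        ((∑ᶠ j₁ : ℤ, P.dualBarTerm (j₁ := j₁) (j₂ := j - 1 - j₁) i h (by omega)) φ) =
      (∑ᶠ j₁ : ℤ, Q.dualBarTerm (j₁ := j₁) (j₂ := j' - 1 - j₁) i h (by omega))
        (e.dualSuspend.equiv ha hj φ) := by
  by_cases hmn : G.supp m ∧ G.supp n
  · obtain ⟨hm, hn⟩ := hmn
    -- The `finsum` is formed in a space of linear maps and is zero by convention if its support is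
    -- infinite. An equivalence of the whole spaces of maps commutes with it in either case, so
    -- finiteness need not be checked.
    let F : ((P.suspend (-1)).desuspendDual.carrier a j →ₗ[𝕜]
          (free P.dualBarGen).carrier a (j - 1)) ≃ₗ[𝕜]
        ((Q.suspend (-1)).desuspendDual.carrier a j' →ₗ[𝕜]
          (free Q.dualBarGen).carrier a (j' - 1)) :=
      LinearEquiv.arrowCongr (e.dualSuspend.equiv ha hj) (e.dualBarGen.freeIso.equiv ha hj1)
    have h1 := F.toAddEquiv.map_finsum
      (fun j₁ : ℤ => P.dualBarTerm (j₁ := j₁) (j₂ := j - 1 - j₁) i h (by omega))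
    have h2 := finsum_comp_equiv (Equiv.addRight (G.shift m))
      (f := fun j₁ : ℤ => Q.dualBarTerm (j₁ := j₁) (j₂ := j' - 1 - j₁) (j := j') i h (by omega))
    rw [← h2]
    have h3 : ∀ j₁ : ℤ, F (P.dualBarTerm (j₁ := j₁) (j₂ := j - 1 - j₁) (j := j) i h (by omega)) =
        Q.dualBarTerm (j₁ := j₁ + G.shift m) (j₂ := j' - 1 - (j₁ + G.shift m)) (j := j')
          i h (by omega) := by
      intro j₁
      ext φ
      refine (e.dualBarTerm hm hn ha rfl (j₂' := j' - 1 - (j₁ + G.shift m)) ?_ hj hj1 i h _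
        (by omega) _).trans ?_
      · rw [hj, G.shift_circ h hm hn]; ring
      · exact congrArg _ (LinearEquiv.apply_symm_apply _ φ)
    have h4 := LinearMap.congr_fun (h1.trans (finsum_congr h3)) (e.dualSuspend.equiv ha hj φ)
    refine Eq.trans ?_ h4
    refine congrArg (e.dualBarGen.freeIso.equiv ha hj1) (congrArg _ ?_)
    exact (LinearEquiv.symm_apply_apply _ _).symm
  · have h1 : ∀ j₁ : ℤ,
        P.dualBarTerm (j₁ := j₁) (j₂ := j - 1 - j₁) (j := j) i h (by omega) = 0 := fun j₁ =>
      P.dualBarTerm_eq_zero e.dualBarGen.eq_zero_left i h _ hmn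
    have h2 : ∀ j₁ : ℤ,
        Q.dualBarTerm (j₁ := j₁) (j₂ := j' - 1 - j₁) (j := j') i h (by omega) = 0 := fun j₁ =>
      Q.dualBarTerm_eq_zero e.dualBarGen.eq_zero_right i h _ hmn
    simp only [h1, h2, finsum_zero, LinearMap.zero_apply, map_zero]

lemma Operad.ShiftIso.dualBarDiffGen (e : Operad.ShiftIso G.neg P Q) {a : ℕ} {j j' : ℤ}
    (ha : G.supp a) (hj : j' = j + G.shift a) (hj1 : j' - 1 = j - 1 + G.shift a)
    (x : P.dualBarGen.carrier a j) :
    e.dualBarGen.freeIso.equiv ha hj1 (P.dualBarDiffGen a j x) =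
      Q.dualBarDiffGen a j' (e.dualBarGen.equiv ha hj x) := by
  simp only [Operad.dualBarDiffGen, LinearMap.sum_apply, LinearMap.smul_apply, map_sum, map_smul,
    LinearMap.comp_apply]
  refine Finset.sum_congr rfl fun mn _ => congrArg _ (Finset.sum_congr rfl fun i _ =>
    Finset.sum_congr rfl fun σ _ => ?_)
  rw [e.dualBarGen.freeIso.map_act, e.finsum_dualBarTerm ha hj hj1, e.dualSuspend.map_act,
    e.dualBarGen_incl]

lemma Operad.ShiftIso.dualBarDiff (e : Operad.ShiftIso G.neg P Q) {a : ℕ} {j j' : ℤ}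
    (ha : G.supp a) (hj : j' = j + G.shift a) (hj1 : j' - 1 = j - 1 + G.shift a)
    (x : P.dualBar.carrier a j) :
    e.dualBarGen.freeIso.equiv ha hj1 (P.dualBarDiff a j x) =
      Q.dualBarDiff a j' (e.dualBarGen.freeIso.equiv ha hj x) :=
  e.dualBarGen.freeIso_freeDeriv _ _ e.dualBarDiffGen ha hj hj1 x

/-! ### Koszul duals and the natural map -/

/-- The Koszul duals of quadratic operads with the same relations are isomorphic up to the
opposite regrading. -/
def quadDualIso {n : ℕ} {d d' : ℤ} (hn : G.supp n) (hn1 : 1 ≤ n) (hd : d' = d + G.shift n)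
    (R : Set (QuadCoord 𝕜 n)) : Operad.ShiftIso G.neg (quadDual n d R) (quadDual n d' R) :=
  -- The dual generator has degree `-d + n - 2`, hence the opposite shift; `quadPerp` depends on `n`
  -- and `R` but not on the degree.
  quadraticIso (G := G.neg) hn hn1 (by rw [hd]; simp only [Regrading.neg]; ring) (quadPerp n R)

/-- The map is `φ ↦ ∑ φ(σ μ^∨) σ μ` in both degrees, and the regrading isomorphisms take `μ` to `μ`
and `μ^∨` to `μ^∨` equivariantly. -/
lemma naturalGen_shift {n : ℕ} {d d' : ℤ} (hn : G.supp n) (hn1 : 1 ≤ n)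
    (hd : d' = d + G.shift n) (R : Set (QuadCoord 𝕜 n)) {a : ℕ} {j j' : ℤ} (ha : G.supp a)
    (hj : j' = j + G.shift a) (x : (quadDual n d R).dualBarGen.carrier a j) :
    (quadraticIso hn hn1 hd R).equiv ha hj (naturalGen n d R a j x) =
      naturalGen n d' R a j' ((quadDualIso hn hn1 hd R).dualBarGen.equiv ha hj x) := by
  by_cases h : a = n ∧ j = d
  · have h' : a = n ∧ j' = d' := ⟨h.1, by rw [hj, hd, h.1, h.2]⟩
    simp only [naturalGen, dif_pos h, dif_pos h', LinearMap.sum_apply, map_sum,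
      LinearMap.smulRight_apply, LinearMap.comp_apply, map_smul]
    refine Finset.sum_congr rfl fun σ _ => ?_
    rw [(quadraticIso hn hn1 hd R).map_act, quadraticIso_quadGen hn hn1 hd R ha hj h h']
    congr 1
    let ψ : Module.Dual 𝕜 (((quadDual n d R).suspend (-1)).carrier a (-(j + 1))) :=
      (quadDual n d R).dualBarIncl a j x
    -- The transported functional is `ψ` after the inverse isomorphism, so equality of coefficients
    -- reduces to matching `σ μ^∨` in the two desuspended duals.
    refine congrArg (fun z => ψ z) ((LinearEquiv.eq_symm_apply _).2 ?_)
    refine (((quadDualIso hn hn1 hd R).suspend (-1)).map_act ha (G.neg_succ_eq hj) σ _).trans ?_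
    refine congrArg _ ?_
    exact quadraticIso_quadGen (G := G.neg) hn hn1 _ _ ha _ _ _
  · have h' : ¬ (a = n ∧ j' = d') := fun h' => h ⟨h'.1, by
      have h2 := h'.2
      rw [hj, hd, h'.1] at h2
      exact add_right_cancel h2⟩
    simp only [naturalGen, dif_neg h, dif_neg h', LinearMap.zero_apply, map_zero]

lemma naturalMap_shift {n : ℕ} {d d' : ℤ} (hn : G.supp n) (hn1 : 1 ≤ n)
    (hd : d' = d + G.shift n) (R : Set (QuadCoord 𝕜 n)) {a : ℕ} {j j' : ℤ} (ha : G.supp a)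
    (hj : j' = j + G.shift a) (x : (quadDual n d R).dualBar.carrier a j) :
    (quadraticIso hn hn1 hd R).equiv ha hj (naturalMap n d R a j x) =
      naturalMap n d' R a j' ((quadDualIso hn hn1 hd R).dualBarGen.freeIso.equiv ha hj x) :=
  (quadDualIso hn hn1 hd R).dualBarGen.freeIso_freeLift _ _ _
    (naturalGen_shift hn hn1 hd R) ha hj x

/-! ### Transport of Koszulness -/

open Classical in
/-- Conjugation of an isomorphism of operads by isomorphisms up to a regrading. -/
def Operad.Iso.shift {P' Q' : Operad 𝕜} (f : Operad.Iso P Q) (e : Operad.ShiftIso G P P')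
    (e' : Operad.ShiftIso G Q Q') : Operad.Iso P' Q' where
  toEquiv a j :=
    if ha : G.supp a then
      (e.equiv ha (sub_add_cancel j _).symm).symm ≪≫ₗ f.toEquiv a (j - G.shift a) ≪≫ₗ
        e'.equiv ha (sub_add_cancel j _).symm
    else
      { (0 : P'.carrier a j →ₗ[𝕜] Q'.carrier a j) with
        invFun := 0
        left_inv := fun x => (e.eq_zero_right ha x).symm
        right_inv := fun x => (e'.eq_zero_right ha x).symm }
  map_one j hj := by
    have h0 : j - G.shift 1 = 0 := by rw [hj, G.shift_one, sub_zero]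
    simp only [dif_pos G.supp_one, LinearEquiv.trans_apply]
    rw [(LinearEquiv.symm_apply_eq _).2
        (e.map_one G.supp_one (sub_add_cancel j _).symm h0 hj).symm, f.map_one,
      e'.map_one G.supp_one _ h0 hj]
  map_act a j σ x := by
    by_cases ha : G.supp a
    · simp only [dif_pos ha, LinearEquiv.trans_apply]
      rw [← e'.map_act, ← f.map_act]
      congr 2
      rw [LinearEquiv.symm_apply_eq, e.map_act, LinearEquiv.apply_symm_apply]
    · exact (e'.eq_zero_right ha _).trans (e'.eq_zero_right ha _).symm
  map_circ {m n l p q r} i h hd x y := by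
    by_cases hm : G.supp m
    · by_cases hn : G.supp n
      · have hl := G.supp_circ h hm hn
        have hd' : p - G.shift m + (q - G.shift n) = r - G.shift l := by
          rw [G.shift_circ h hm hn]; linarith
        simp only [dif_pos hm, dif_pos hn, dif_pos hl, LinearEquiv.trans_apply]
        rw [← e'.map_circ hm hn hl _ _ (sub_add_cancel r _).symm i h hd' hd, ← f.map_circ]
        congr 2
        rw [LinearEquiv.symm_apply_eq,
          e.map_circ hm hn hl (sub_add_cancel p _).symm (sub_add_cancel q _).symm
            (sub_add_cancel r _).symm i h hd' hd,
          LinearEquiv.apply_symm_apply, LinearEquiv.apply_symm_apply]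
      · rw [e.eq_zero_right hn y]
        simp only [map_zero]
    · rw [e.eq_zero_right hm x]
      simp only [map_zero, LinearMap.zero_apply]

/-- Koszulness is invariant under regrading. -/
lemma IsKoszul.shift {n : ℕ} {P P' : Operad 𝕜} (hP : IsKoszul n P) (hn : G.supp n) (hn1 : 1 ≤ n)
    (e : Operad.ShiftIso G P P') : IsKoszul n P' := by
  obtain ⟨d, R, ⟨f⟩, hK⟩ := hP
  let E := quadraticIso hn hn1 (rfl : d + G.shift n = d + G.shift n) R
  let D := quadDualIso hn hn1 (rfl : d + G.shift n = d + G.shift n) R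
  let B := D.dualBarGen.freeIso
  -- The new presentation has the same relations with the generator moved by `G.shift n`; `f` is
  -- conjugated by the regradings of its source and target.
  refine ⟨d + G.shift n, R, ⟨f.shift E e⟩, fun a j => ?_⟩
  by_cases ha : G.supp a
  · obtain ⟨k, rfl⟩ : ∃ k, j = k + G.shift a := ⟨j - G.shift a, (sub_add_cancel j _).symm⟩
    have hk1 : k + G.shift a - 1 = k - 1 + G.shift a := by ring
    obtain ⟨hs, hi⟩ := hK a k
    constructor
    · intro y
      obtain ⟨z, hz, hzy⟩ := hs ((E.equiv ha rfl).symm y)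
      refine ⟨B.equiv ha rfl z, ?_, ?_⟩
      · exact (D.dualBarDiff ha rfl hk1 z).symm.trans ((congrArg _ hz).trans (map_zero _))
      · rw [← naturalMap_shift hn hn1 rfl R ha rfl, hzy]
        exact LinearEquiv.apply_symm_apply _ y
    · intro z hz hz0
      have hk2 : k + G.shift a - 1 - 1 = k - 1 - 1 + G.shift a := by ring
      obtain ⟨z, rfl⟩ := (B.equiv ha hk1).surjective z
      -- Injectivity of the regrading isomorphisms shows that the preimage of a cycle with value
      -- zero is again one, so it bounds before regrading.
      obtain ⟨w, hw⟩ := hi z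
        ((B.equiv ha hk2).injective
          ((D.dualBarDiff ha hk1 hk2 z).trans (hz.trans (map_zero _).symm)))
        ((E.equiv ha hk1).injective
          ((naturalMap_shift hn hn1 rfl R ha hk1 z).trans (hz0.trans (map_zero _).symm)))
      refine ⟨B.equiv ha rfl w, ?_⟩
      rw [← D.dualBarDiff ha rfl hk1, hw]
  · refine ⟨fun y => ⟨0, map_zero _, ?_⟩, fun z _ _ => ⟨0, ?_⟩⟩
    · exact (E.eq_zero_right ha _).trans (E.eq_zero_right ha y).symm
    · exact (map_zero _).trans (B.eq_zero_right ha z).symm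

/-! ### The weight regrading and the four families -/

/-- The regrading that shifts the degree by `c` for each operation of arity `n` in a composite. -/
def Regrading.weight (n : ℕ) (hn : 2 ≤ n) (c : ℤ) (hc : Even c) : Regrading where
  supp a := ∃ k : ℕ, a = 1 + k * (n - 1)
  -- For `a = 1 + k(n-1)` the quotient is `k`, the number of generators in a composite of arity `a`.
  -- In other arities the truncated value plays no role.
  shift a := c * ((a - 1) / (n - 1) : ℕ)
  supp_one := ⟨0, by simp⟩
  shift_one := by simp
  supp_circ := by
    rintro m n' l h ⟨k, rfl⟩ ⟨k', rfl⟩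
    exact ⟨k + k', by rw [add_mul]; omega⟩
  shift_circ := by
    rintro m n' l h ⟨k, rfl⟩ ⟨k', rfl⟩
    obtain rfl : l = 1 + (k + k') * (n - 1) := by rw [add_mul]; omega
    -- Recovering the weight from the arity requires `n ≥ 2`.
    have h0 : 0 < n - 1 := by omega
    simp only [Nat.add_sub_cancel_left, Nat.mul_div_cancel _ h0]
    push_cast
    ring
  even_shift _ := hc.mul_right _

lemma Regrading.weight_supp (n : ℕ) (hn : 2 ≤ n) (c : ℤ) (hc : Even c) :
    (Regrading.weight n hn c hc).supp n :=
  ⟨1, by omega⟩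

lemma Regrading.weight_shift (n : ℕ) (hn : 2 ≤ n) (c : ℤ) (hc : Even c) :
    (Regrading.weight n hn c hc).shift n = c := by
  simp only [Regrading.weight, Nat.div_self (show 0 < n - 1 by omega)]
  simp

/-- The members of each of the four families whose degrees have the same parity are isomorphic up to
a regrading. -/
lemma IsKoszul.of_even_sub {n : ℕ} (hn : 2 ≤ n) {P : ℤ → Operad 𝕜}
    (hP : P = tAss 𝕜 n ∨ P = pAss 𝕜 n ∨ P = tAssTilde 𝕜 n ∨ P = pAssTilde 𝕜 n)
    {d d' : ℤ} (hd : Even (d' - d)) (h : IsKoszul n (P d)) : IsKoszul n (P d') := by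
  have hs := Regrading.weight_supp n hn (d' - d) hd
  have hw := Regrading.weight_shift n hn (d' - d) hd
  suffices H : Nonempty (Operad.ShiftIso (Regrading.weight n hn (d' - d) hd) (P d) (P d')) from
    h.shift hs (by omega) H.some
  rcases hP with rfl | rfl | rfl | rfl
  · exact ⟨quadraticIso hs (by omega) (by rw [hw]; ring) _⟩
  · exact ⟨quadraticIso hs (by omega) (by rw [hw]; ring) _⟩
  -- The offsets `- n + 1` here and `+ n - 1` in the last case are the same for `d` and `d'`, so the
  -- generators before suspension still differ by `d' - d`, and suspension preserves the regrading.
  · exact ⟨(quadraticIso hs (by omega) (by rw [hw]; ring) _ :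
      Operad.ShiftIso _ (tAss 𝕜 n (d - n + 1)) (tAss 𝕜 n (d' - n + 1))).suspend 1⟩
  · exact ⟨(quadraticIso hs (by omega) (by rw [hw]; ring) _ :
      Operad.ShiftIso _ (pAss 𝕜 n (d + n - 1)) (pAss 𝕜 n (d' + n - 1))).suspend (-1)⟩

end

end Operads

end

theorem lemmao {𝕜 : Type*} [Field 𝕜] [CharZero 𝕜] (n : ℕ) (hn : 2 ≤ n)
    (P : ℤ → Operads.Operad 𝕜)
    (hP : P = Operads.tAss 𝕜 n ∨ P = Operads.pAss 𝕜 n ∨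
      P = Operads.tAssTilde 𝕜 n ∨ P = Operads.pAssTilde 𝕜 n) :
    (∀ d : ℤ, Operads.IsKoszul n (P d) ↔ Operads.IsKoszul n (P (d + 2))) ∧
    (∀ d d' : ℤ, d ≡ d' [ZMOD 2] →
      (Operads.IsKoszul n (P d) ↔ Operads.IsKoszul n (P d'))) := by
  have key : ∀ d d' : ℤ, d ≡ d' [ZMOD 2] →
      (Operads.IsKoszul n (P d) ↔ Operads.IsKoszul n (P d')) := fun d d' h =>
    ⟨Operads.IsKoszul.of_even_sub hn hP (even_iff_two_dvd.2 h.dvd),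
      Operads.IsKoszul.of_even_sub hn hP (even_iff_two_dvd.2 h.symm.dvd)⟩
  exact ⟨fun d => key d (d + 2) (by simp [Int.ModEq]), key⟩
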